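/- There are absolute constants $c_0, C > 0$ such that the following holds. Let $d\ge 1$, $n\ge 2$, $\rho>0$, $0<\beta<1$, $0<\sigma_{\min}\le\sigma_{\max}$, $R\in\mathbb R$, $\mu\in\mathbb R^d$ with $\|\mu\|_2\le R$, and $\Sigma\in\mathbb R^{d\times d}$ symmetric with $\sigma_{\min}^2 I\preceq\Sigma\preceq\sigma_{\max}^2 I$. Put $$R' = R+2\sigma_{\max}\sqrt{d+\log\tfrac{4n}{\beta}},\qquad u=\frac{2R'\sqrt n}{\sigma_{\min}},\qquad \tau=\sqrt{\frac{\log(du)\,\log\frac{4d\log(du)}{\beta}}{\rho}},$$ and assume $n\ge c_0\,\tau\sqrt d$. Let $x_1,\dots,x_n$ be i.i.d. samples from $\mathcal N(\mu,\Sigma)$, and let $\hat\mu$ be the output of the following randomized algorithm, all of whose random bits are independent of each other and of the samples. Then, with probability at least $1-\beta$, $$\|\hat\mu-\mu\|_2\le C\,\|\Sigma^{1/2}\|_2\sqrt{d+\log\tfrac n\beta}\left(\frac1{\sqrt n}+\frac{\sqrt d\,\log\frac{nd}\beta}{\sqrt\rho\, n}+\frac{\tau\log\frac{nd}{\beta}}{n}\right),$$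 where $\|\Sigma^{1/2}\|_2$ is the spectral norm. **Algorithm.** (1) *Clip*: replace $x_i$ by $x_i\cdot\min\{R'/\|x_i\|_2,1\}$. (2) *Quantize*: with $\alpha=\sigma_{\min}\sqrt{d/n}$ and bucket size $b=\alpha/\sqrt d$, replace each coordinate $t$ by the integer $\lfloor (t+R')/b\rfloor\in\{0,\dots,U\}$, $U=\lfloor u\rfloor$, and pad by zeros to dimension $D=2^{\lceil\log_2 d\rceil}$. (3) *Rotate*: multiply each integer vector by $A=H\,\mathrm{diag}(s)$, where $H$ is the $D\times D$ Sylvester–Hadamard matrix and $s\in\{\pm1\}^D$ is uniform. (4) *Shift*: for each coordinate $j$ let $\tilde c_j$ be the output of $\mathrm{PrivQuant}$, with privacy parameter $\rho/(4D)$ and rank $n/2$, on the $j$-th coordinates of the rotated vectors (over $\{-DU,\dots,DU\}$, translated by $DU$ to $\{0,\dots,2DU\}$ for the search); subtract $\tilde c$ from each rotated vector, giving $\tilde x_1,\dots,\tilde x_n$. (5) *Clipped mean*, with $\rho_1=\frac34\rho$ and $\beta_1=\beta/12$: let $V=D(2DU)^2$, let $L$ be the number of rounds of $\mathrm{PrivQuant}$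 over $\{0,\dots,V\}$, let $\tau_1=\sqrt{L\log(2L/\beta_1)/(\rho_1/4)}$ (the rank error of $\mathrm{PrivQuant}$ with parameter $\rho_1/4$ at failure probability $\beta_1$), and let $t=\max\{\sqrt{2D/\rho_1},\tau_1\}$. If $n\le t$ let $\tilde y=0$. Otherwise let $\tilde C$ be the square root of the output of $\mathrm{PrivQuant}$, with parameter $\rho_1/4$ and rank $\max\{n-t,1\}$, on $\{\|\tilde x_i\|_2^2\}_i\subset\{0,\dots,V\}$, and let $\tilde y=\frac1n\sum_i\min\{\tilde C/\|\tilde x_i\|_2,1\}\tilde x_i+\mathcal N\big(0,\tfrac{2\tilde C^2}{(3\rho_1/4)n^2}I\big)$. (6) Let $y=(\tfrac1{\sqrt D}A)^{-1}\tfrac1{\sqrt D}(\tilde y+\tilde c)$; discard the padding and return $\hat\mu_j=b\,y_j-R'$ for $j\le d$. Here $\mathrm{PrivQuant}$ with privacy parameter $\rho'$ and rank $m$, on integers in $\{0,\dots,U'\}$, is the following binary search, with $L=\lceil\log_2(U'+1)\rceil$ the maximal number of rounds: start with $\mathrm{left}=0$, $\mathrm{right}=U'$; while $\mathrm{left}<\mathrm{right}$,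 put $\mathrm{mid}=\lfloor(\mathrm{left}+\mathrm{right})/2\rfloor$, add fresh noise $\mathcal N(0,L/(2\rho'))$ to the number of data in $[0,\mathrm{mid}]$, and if the result is $\le m$ set $\mathrm{left}=\mathrm{mid}+1$, else set $\mathrm{right}=\mathrm{mid}$; return $\lfloor(\mathrm{left}+\mathrm{right})/2\rfloor$. -/

import Mathlib

open MeasureTheory ProbabilityTheory
open scoped Matrix MatrixOrder Kronecker

noncomputable section

namespace PrivMean

/-! ### Private quantile selection by binary search -/

/-- The maximal number of iterations of a binary search over `{0, …, U}`, i.e. `⌈log₂ (U + 1)⌉`. -/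
def rounds (U : ℕ) : ℕ := Nat.clog 2 (U + 1)

/-- The number of elements of the data set `x` that lie in the range `[0, mid]`. -/
def rangeCount {n : ℕ} (x : Fin n → ℤ) (mid : ℕ) : ℕ :=
  (Finset.univ.filter fun i => 0 ≤ x i ∧ x i ≤ (mid : ℤ)).card

/-- The loop of the noisy binary search for the rank-`m` element, with current interval
`[left, right]` and at most `N` further iterations. Iteration by iteration it compares `m` with the
noisy count `|x ∩ [0, mid]| + s * z`, where the `z`s are the (standard normal) noises still
unused. -/
def privQuantLoop {n : ℕ} (x : Fin n → ℤ) (m s : ℝ) :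
    (N : ℕ) → (Fin N → ℝ) → (left right : ℕ) → ℕ
  | 0, _, left, right => (left + right) / 2
  | N + 1, z, left, right =>
    if left < right then
      if (rangeCount x ((left + right) / 2) : ℝ) + s * z 0 ≤ m then
        privQuantLoop x m s N (fun t => z t.succ) ((left + right) / 2 + 1) right
      else
        privQuantLoop x m s N (fun t => z t.succ) left ((left + right) / 2)
    else (left + right) / 2

/-- `PrivQuant`: an approximation of the rank-`m` element of the data set `x` of integers in
`{0, …, U}`, with privacy parameter `ρ`; every noisy range count uses fresh noise
`N(0, L / (2ρ))`, with `L = rounds U`. -/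
def privQuant {n : ℕ} (x : Fin n → ℤ) (U : ℕ) (m ρ : ℝ) (z : Fin (rounds U) → ℝ) : ℕ :=
  privQuantLoop x m (√((rounds U : ℝ) / (2 * ρ))) (rounds U) z 0 U

/-- The rank error of `privQuant`: with `L = rounds U`, the union bound of the Gaussian tail
`2 exp (-τ² / (2σ²))`, `σ² = L / (2ρ)`, over `L` noises equals `β` at this value `τ`. -/
def rankErr (U : ℕ) (ρ β : ℝ) : ℝ :=
  √((rounds U : ℝ) * Real.log (2 * (rounds U : ℝ) / β) / ρ)

/-! ### The clipped-mean estimator -/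

/-- Scaling of `x` to Euclidean norm at most `C`. -/
def clip {D : ℕ} (C : ℝ) (x : EuclideanSpace ℝ (Fin D)) : EuclideanSpace ℝ (Fin D) :=
  min (C / ‖x‖) 1 • x

/-- The clipped-mean estimator `M_C`, i.e. the mean of the clipped data plus
`N(0, 2C² / (ρ n²) I)`; here `z` is the standard normal noise vector. -/
def clippedMean {n D : ℕ} (x : Fin n → EuclideanSpace ℝ (Fin D)) (C ρ : ℝ)
    (z : EuclideanSpace ℝ (Fin D)) : EuclideanSpace ℝ (Fin D) :=
  (1 / (n : ℝ)) • ∑ i, clip C (x i) + √(2 * C ^ 2 / (ρ * (n : ℝ) ^ 2)) • z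

/-- An integer vector as a point of Euclidean space. -/
def toEuc {D : ℕ} (v : Fin D → ℤ) : EuclideanSpace ℝ (Fin D) :=
  WithLp.toLp 2 fun j => (v j : ℝ)

/-- The clipped-mean estimator with privately selected threshold, for integer vectors whose
coordinates have absolute value at most `u`. The squared norms lie in `{0, …, D u²}`; their
quantile of rank `max (n - max (√(2D/ρ)) τ) 1` is selected with privacy parameter `ρ/4`, and the
clipped mean is released with parameter `3ρ/4`. If `n ≤ max (√(2D/ρ)) τ`, the output is `0`. -/
def adaptiveClippedMean {n D : ℕ} (x : Fin n → Fin D → ℤ) (u : ℕ) (ρ β : ℝ)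
    (zq : Fin (rounds (D * u ^ 2)) → ℝ) (z : EuclideanSpace ℝ (Fin D)) :
    EuclideanSpace ℝ (Fin D) :=
  let t : ℝ := max (√(2 * (D : ℝ) / ρ)) (rankErr (D * u ^ 2) (ρ / 4) β)
  if (n : ℝ) ≤ t then 0
  else
    let v : ℕ := privQuant (fun i => ∑ j, x i j ^ 2) (D * u ^ 2) (max ((n : ℝ) - t) 1) (ρ / 4) zq
    clippedMean (fun i => toEuc (x i)) (√(v : ℝ)) (3 / 4 * ρ) z

/-! ### The shifted-clipped-mean estimator -/

/-- The (Sylvester) Hadamard matrix of order `2 ^ k`: `k`-th Kronecker power of `(1 1; 1 -1)`. -/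
def hadamard : (k : ℕ) → Matrix (Fin (2 ^ k)) (Fin (2 ^ k)) ℤ
  | 0 => 1
  | k + 1 =>
    Matrix.reindex (finProdFinEquiv.trans (finCongr (pow_succ' 2 k).symm))
      (finProdFinEquiv.trans (finCongr (pow_succ' 2 k).symm))
      ((!![1, 1; 1, -1] : Matrix (Fin 2) (Fin 2) ℤ) ⊗ₖ hadamard k)

theorem isHadamard_hadamard (k : ℕ) : (hadamard k).IsHadamard := by
  induction k with
  | zero =>
    refine ⟨fun i j => ?_, by simp [hadamard], by simp [hadamard]⟩
    obtain rfl : i = j := Fin.ext (by have := i.2; have := j.2; omega)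
    simp [hadamard, one_mem]
  | succ k ih =>
    refine Matrix.IsHadamard.reindex _ _ (Matrix.IsHadamard.kronecker ⟨?_, ?_, ?_⟩ ih)
    · intro i j
      fin_cases i <;> fin_cases j <;> simp [Unitary.mem_iff]
    · ext i j
      fin_cases i <;> fin_cases j <;> simp [Matrix.mul_apply, Fin.sum_univ_two]
    · ext i j
      fin_cases i <;> fin_cases j <;> simp [Matrix.mul_apply, Fin.sum_univ_two]

/-- The sign encoded by a bit. -/
def sign (b : Bool) : ℤ := if b then 1 else -1

/-- The unnormalized random rotation `H D`, where `D` is the diagonal matrix of the signs `s`. -/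
def rotation {k : ℕ} (s : Fin (2 ^ k) → Bool) : Matrix (Fin (2 ^ k)) (Fin (2 ^ k)) ℤ :=
  hadamard k * Matrix.diagonal fun j => sign (s j)

/-- The random bits used by the shifted-clipped-mean estimator in dimension `D`, for coordinates in
`{0, …, U}`: the signs of the rotation, the noises of the `D` median searches (over a universe
`{0, …, 2DU}`), the noises of the search of the clipping threshold (over `{0, …, D (2DU)²}`), and
the noise added to the clipped mean. -/
abbrev Noise (D U : ℕ) : Type :=
  (Fin D → Bool) × (Fin D → Fin (rounds (2 * (D * U))) → ℝ) ×
    (Fin (rounds (D * (2 * (D * U)) ^ 2)) → ℝ) × EuclideanSpace ℝ (Fin D)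

/-- The law of the random bits: all independent, the signs uniform, the noises standard normal. -/
def noiseLaw (D U : ℕ) : Measure (Noise D U) :=
  (Measure.pi fun _ => (PMF.uniformOfFintype Bool).toMeasure).prod
    ((Measure.pi fun _ => Measure.pi fun _ => gaussianReal 0 1).prod
      ((Measure.pi fun _ => gaussianReal 0 1).prod (stdGaussian (EuclideanSpace ℝ (Fin D)))))

/-- The private approximate coordinatewise medians `c̃` of integer vectors `x` with coordinates in
`[-B, B]` (moved to `{0, …, 2B}` for the search); parameter `ρ / (4D)` per coordinate. -/
def privCenter {n D : ℕ} (x : Fin n → Fin D → ℤ) (B : ℕ) (ρ : ℝ)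
    (z : Fin D → Fin (rounds (2 * B)) → ℝ) (j : Fin D) : ℤ :=
  (privQuant (fun i => x i j + (B : ℤ)) (2 * B) ((n : ℝ) / 2) (ρ / (4 * (D : ℝ))) (z j) : ℤ) -
    (B : ℤ)

/-- The shifted-clipped-mean estimator for integer vectors with coordinates in `{0, …, U}`, in
dimension `D = 2 ^ k`: rotate to `x̂ᵢ = H D xᵢ` (coordinates in `[-DU, DU]`), shift by the private
medians `c̃`, apply the clipped-mean estimator with parameter `3ρ/4` to `x̂ᵢ - c̃`, and return
`((1/√D) H D)⁻¹ (1/√D) (ỹ + c̃)`. -/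
def shiftedClippedMean {n k : ℕ} (x : Fin n → Fin (2 ^ k) → ℤ) (U : ℕ) (ρ β : ℝ)
    (ω : Noise (2 ^ k) U) : EuclideanSpace ℝ (Fin (2 ^ k)) :=
  let A : Matrix (Fin (2 ^ k)) (Fin (2 ^ k)) ℤ := rotation ω.1
  let xh : Fin n → Fin (2 ^ k) → ℤ := fun i => A *ᵥ x i
  let c : Fin (2 ^ k) → ℤ :=
    privCenter xh (2 ^ k * U) ρ ω.2.1
  let y : EuclideanSpace ℝ (Fin (2 ^ k)) :=
    adaptiveClippedMean (fun i => xh i - c) (2 * (2 ^ k * U)) (3 / 4 * ρ) (β / 3) ω.2.2.1 ω.2.2.2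
  let r : ℝ := 1 / √((2 : ℝ) ^ k)
  Matrix.toEuclideanCLM (𝕜 := ℝ) (r • A.map (Int.cast : ℤ → ℝ))⁻¹ (r • (y + toEuc c))

/-! ### The estimator for Gaussian data -/

/-- The exponent of the dimension `2 ^ ⌈log₂ d⌉` to which vectors are padded. -/
def padExp (d : ℕ) : ℕ := Nat.clog 2 d

theorem le_two_pow_padExp (d : ℕ) : d ≤ 2 ^ padExp d := Nat.le_pow_clog one_lt_two d

/-- Padding of an integer vector by zeros. -/
def pad {d : ℕ} (v : Fin d → ℤ) : Fin (2 ^ padExp d) → ℤ :=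
  fun j => if h : j.val < d then v ⟨j.val, h⟩ else 0

/-- The a priori clipping radius `R' = R + 2 σ_max √(d + log (4n/β))`. -/
def clipRadius (d n : ℕ) (R σmax β : ℝ) : ℝ :=
  R + 2 * σmax * √((d : ℝ) + Real.log (4 * (n : ℝ) / β))

/-- The bucket size `α / √d` of the quantization, where `α = σ_min √(d/n)`. -/
def bucket (d n : ℕ) (σmin : ℝ) : ℝ := σmin * √((d : ℝ) / (n : ℝ)) / √(d : ℝ)

/-- The (real) size `u = 2 R' √n / σ_min` of the integer universe. -/
def univSize (d n : ℕ) (R σmin σmax β : ℝ) : ℝ :=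
  2 * clipRadius d n R σmax β * √(n : ℝ) / σmin

/-- The largest integer of the quantized universe. -/
def univMax (d n : ℕ) (R σmin σmax β : ℝ) : ℕ := ⌊univSize d n R σmin σmax β⌋₊

/-- Quantization of a vector with coordinates in `[-R', R']`: the index of the bucket of length `b`,
counted from `-R'`, that contains the coordinate. -/
def quantize {d : ℕ} (R' b : ℝ) (x : EuclideanSpace ℝ (Fin d)) : Fin d → ℤ :=
  fun j => ⌊(x j + R') / b⌋

/-- The whole algorithm: clip every sample at radius `R'`, quantize with the bucket size `b`, pad to a
power of two, run the shifted-clipped-mean estimator with parameters `ρ` and `β/4`, discard the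
padding, and undo the quantization map. -/
def gaussianMeanEst {n d : ℕ} (R σmin σmax ρ β : ℝ) (x : Fin n → EuclideanSpace ℝ (Fin d))
    (ω : Noise (2 ^ padExp d) (univMax d n R σmin σmax β)) : EuclideanSpace ℝ (Fin d) :=
  let R' := clipRadius d n R σmax β
  let b := bucket d n σmin
  let q : Fin n → Fin d → ℤ := fun i => quantize R' b (clip R' (x i))
  let y : EuclideanSpace ℝ (Fin (2 ^ padExp d)) :=
    shiftedClippedMean (fun i => pad (q i)) (univMax d n R σmin σmax β) ρ (β / 4) ω
  WithLp.toLp 2 fun j => b * y (Fin.castLE (le_two_pow_padExp d) j) - R'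

/-- `τ = √(log (du) log (4d log (du) / β) / ρ)` with `u = 2 R' √n / σ_min`. -/
def tau (d n : ℕ) (R σmin σmax ρ β : ℝ) : ℝ :=
  √(Real.log ((d : ℝ) * univSize d n R σmin σmax β) *
    Real.log (4 * (d : ℝ) * Real.log ((d : ℝ) * univSize d n R σmin σmax β) / β) / ρ)

/-- The spectral norm `‖S^{1/2}‖₂` of the positive semidefinite square root of `S`. -/
def sqrtNorm {d : ℕ} (S : Matrix (Fin d) (Fin d) ℝ) : ℝ :=
  ‖Matrix.toEuclideanCLM (𝕜 := ℝ) (CFC.sqrt S)‖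

end PrivMean

end

namespace PrivMean

/-! ### Tail bounds -/

/-! The proof separates chance from analysis. Outside six bad events the error bound is
deterministic, and a union bound over these events costs at most `β`. On the good event every sample
lies within `K ≈ ‖Σ^{1/2}‖ √(d + log (n/β))` of `μ`, so clipping at `R'` changes nothing. In units
of the bucket size `b`, the quantized data are within `O(K/b)` of the image of `μ`. A Hadamard
matrix with random signs makes each coordinate of a rotated difference a Rademacher sum
(`rademacher_tail`). All rotated points therefore agree, coordinate by coordinate, up to `G/b` with
`G ≈ K √(log (nd/β))`, without the factor `√D` lost by a worst-case bound. The noisy binary search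
keeps a rank invariant (`privQuantLoop_spec`). For the medians, rank error below `n/2` suffices:
each centre then lies between two data coordinates (`privCenter_mem_hull`), so the shifted points
have norm at most `√D · 2G/b`. For the threshold, the selected radius is at most the largest norm
and clips at most `2t` points (`norm_adaptiveClippedMean_sub_le`). The normalized rotation is an
isometry, and its factor `1/√D` cancels the `√D` above. What remains is `(2t + O(‖z‖/√ρ)) · 2G/n`,
plus the rounding bias and the error of the sample mean. The hypothesis `n ≥ 24 τ √d` serves twice:
it makes the medians reliable (`median_failure_le`) and forces `t ≤ n/2` (`trimCount_le`). -/

theorem integral_exp_sq_div_four_gaussianReal :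
    ∫ x, Real.exp (x ^ 2 / 4) ∂(gaussianReal 0 1) = √2 := by
  rw [integral_gaussianReal_eq_integral_smul one_ne_zero]
  have h : ∀ x : ℝ, gaussianPDFReal 0 1 x • Real.exp (x ^ 2 / 4) =
      (√(2 * Real.pi))⁻¹ * Real.exp (-(1 / 4) * x ^ 2) := by
    intro x
    rw [gaussianPDFReal, smul_eq_mul, mul_assoc, ← Real.exp_add]
    congr 2
    · simp
    · simp; ring
  simp_rw [h]
  rw [integral_const_mul, integral_gaussian, ← Real.sqrt_inv, ← Real.sqrt_mul (by positivity)]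
  congr 1
  field_simp [Real.pi_pos.ne']
  norm_num

theorem integrable_exp_sq_div_four_gaussianReal :
    Integrable (fun x => Real.exp (x ^ 2 / 4)) (gaussianReal 0 1) := by
  -- A non-integrable function would have Bochner integral `0`, whereas the integral is `√2`.
  by_contra h
  have := integral_undef h
  rw [integral_exp_sq_div_four_gaussianReal] at this
  norm_num at this

/-- Markov's inequality for `exp (‖z‖² / 4)`, whose mean factors as `√2 ^ d ≤ exp d`; this crude
bound on the moment is absorbed by the `d` in the threshold `4 (d + t)`. -/
theorem pi_gaussianReal_sum_sq_tail (d : ℕ) (t : ℝ) :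
    (Measure.pi fun _ : Fin d => gaussianReal 0 1) {z | 4 * ((d : ℝ) + t) < ∑ i, z i ^ 2} ≤
      ENNReal.ofReal (Real.exp (-t)) := by
  set P := Measure.pi fun _ : Fin d => gaussianReal 0 1
  have hprod : ∀ z : Fin d → ℝ, Real.exp ((∑ i, z i ^ 2) / 4) = ∏ i, Real.exp (z i ^ 2 / 4) := by
    intro z; rw [← Real.exp_sum, Finset.sum_div]
  have hint : Integrable (fun z : Fin d → ℝ => Real.exp ((∑ i, z i ^ 2) / 4)) P := by
    simp_rw [hprod]
    exact Integrable.fintype_prod fun _ => integrable_exp_sq_div_four_gaussianReal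
  have hval : ∫ z, Real.exp ((∑ i, z i ^ 2) / 4) ∂P = √2 ^ d := by
    simp_rw [hprod]
    rw [integral_fintype_prod_eq_prod (fun _ x => Real.exp (x ^ 2 / 4))]
    simp [integral_exp_sq_div_four_gaussianReal]
  have hm := mul_meas_ge_le_integral_of_nonneg (μ := P)
    (Filter.Eventually.of_forall fun z => (Real.exp_pos _).le) hint (Real.exp ((d : ℝ) + t))
  rw [hval] at hm
  have hsub : {z : Fin d → ℝ | 4 * ((d : ℝ) + t) < ∑ i, z i ^ 2} ⊆
      {z | Real.exp ((d : ℝ) + t) ≤ Real.exp ((∑ i, z i ^ 2) / 4)} := by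
    intro z hz
    simp only [Set.mem_ofPred_eq] at hz ⊢
    rw [Real.exp_le_exp]; linarith
  refine (measure_mono hsub).trans ?_
  rw [← ofReal_measureReal]
  refine ENNReal.ofReal_le_ofReal ?_
  have h2 : √2 ^ d ≤ Real.exp d := by
    have : √2 ≤ Real.exp 1 := by
      have h1 : √2 ≤ 2 := by rw [Real.sqrt_le_left] <;> norm_num
      linarith [Real.add_one_le_exp (1 : ℝ)]
    calc √2 ^ d ≤ Real.exp 1 ^ d := by gcongr
      _ = Real.exp d := by rw [← Real.exp_nat_mul]; simp
  rw [Real.exp_add, mul_assoc] at hm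
  have h3 := le_of_mul_le_mul_left (hm.trans (by simpa using h2) : Real.exp (d : ℝ) * _ ≤
    Real.exp (d : ℝ) * 1) (Real.exp_pos _)
  rw [Real.exp_neg]
  rw [← mul_le_mul_iff_right₀ (Real.exp_pos t), mul_inv_cancel₀ (Real.exp_pos t).ne']
  simpa only [Real.exp_add] using h3

theorem stdGaussian_norm_tail (d : ℕ) {t : ℝ} (ht : 0 ≤ t) :
    stdGaussian (EuclideanSpace ℝ (Fin d)) {z | 2 * √((d : ℝ) + t) < ‖z‖} ≤
      ENNReal.ofReal (Real.exp (-t)) := by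
  rw [← map_pi_eq_stdGaussian, Measure.map_apply (by fun_prop)
    (measurableSet_lt measurable_const measurable_norm)]
  refine (measure_mono ?_).trans (pi_gaussianReal_sum_sq_tail d t)
  intro z hz
  simp only [Set.mem_preimage, Set.mem_ofPred_eq] at hz ⊢
  have h := pow_lt_pow_left₀ hz (by positivity) two_ne_zero
  rw [mul_pow, Real.sq_sqrt (by positivity), EuclideanSpace.real_norm_sq_eq] at h
  norm_num at h
  simpa using h

/-- Characteristic functions multiply, and `n · ‖t/√n‖² = ‖t‖²`. This gives the sample mean the same
tail as one sample, improved by `1/√n`. -/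
theorem map_sum_pi_stdGaussian {n d : ℕ} (hn : 0 < n) :
    (Measure.pi fun _ : Fin n => stdGaussian (EuclideanSpace ℝ (Fin d))).map
      (fun z => (√(n : ℝ))⁻¹ • ∑ i, z i) = stdGaussian (EuclideanSpace ℝ (Fin d)) := by
  have hn' : (0 : ℝ) < n := by exact_mod_cast hn
  have hcomp : (fun z : Fin n → EuclideanSpace ℝ (Fin d) => (√(n : ℝ))⁻¹ • ∑ i, z i) =
      (fun y => (√(n : ℝ))⁻¹ • y) ∘ fun z => ∑ i, z i := rfl
  have hmeas : Measurable fun z : Fin n → EuclideanSpace ℝ (Fin d) => ∑ i, z i := by fun_prop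
  rw [hcomp, ← Measure.map_map (by fun_prop) hmeas]
  have : IsProbabilityMeasure ((Measure.pi fun _ : Fin n =>
      stdGaussian (EuclideanSpace ℝ (Fin d))).map fun z => ∑ i, z i) :=
    Measure.isProbabilityMeasure_map hmeas.aemeasurable
  have : IsProbabilityMeasure (((Measure.pi fun _ : Fin n =>
      stdGaussian (EuclideanSpace ℝ (Fin d))).map fun z => ∑ i, z i).map
      fun y => (√(n : ℝ))⁻¹ • y) :=
    Measure.isProbabilityMeasure_map (by fun_prop)
  apply Measure.ext_of_charFun
  ext t
  rw [charFun_map_smul, charFun_map_sum_pi_eq_prod]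
  simp only [Finset.prod_apply, charFun_stdGaussian, Finset.prod_const, Finset.card_univ,
    Fintype.card_fin]
  rw [← Complex.exp_nat_mul]
  congr 1
  rw [norm_smul]
  simp only [norm_inv, Real.norm_eq_abs, abs_of_nonneg (Real.sqrt_nonneg _)]
  push_cast
  rw [mul_pow, inv_pow, ← Complex.ofReal_pow (√(n : ℝ)), Real.sq_sqrt hn'.le]
  have : (n : ℂ) ≠ 0 := by exact_mod_cast hn.ne'
  push_cast
  field_simp

theorem hasSubgaussianMGF_const_mul_nnnorm {Ω : Type*} [MeasurableSpace Ω] {P : Measure Ω}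
    {X : Ω → ℝ} {c : NNReal} (h : HasSubgaussianMGF X c P) (r : ℝ) :
    HasSubgaussianMGF (fun ω => r * X ω) (‖r‖₊ ^ 2 * c) P := by
  have key : ∀ x : NNReal, x = ⟨r ^ 2, sq_nonneg r⟩ →
      HasSubgaussianMGF (fun ω => r * X ω) (x * c) P := by
    rintro x rfl
    exact h.const_mul r
  refine key _ (NNReal.eq ?_)
  change ((‖r‖₊ ^ 2 : NNReal) : ℝ) = r ^ 2
  simp

theorem gaussianReal_abs_tail {s e : ℝ} (he : 0 ≤ e) :
    gaussianReal 0 1 {z | e ≤ |s * z|} ≤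
      ENNReal.ofReal (2 * Real.exp (-e ^ 2 / (2 * s ^ 2))) := by
  have hsub : HasSubgaussianMGF (fun z : ℝ => z) 1 (gaussianReal 0 1) := by
    refine ⟨fun t => integrable_exp_mul_gaussianReal t, fun t => ?_⟩
    rw [mgf_fun_id_gaussianReal]; simp
  have h1 := (hasSubgaussianMGF_const_mul_nnnorm hsub s).measure_ge_le he
  have h2 := (hasSubgaussianMGF_const_mul_nnnorm hsub s).neg.measure_ge_le he
  have hset : {z : ℝ | e ≤ |s * z|} ⊆ {z | e ≤ s * z} ∪ {z | e ≤ (-fun z => s * z) z} := by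
    intro z hz
    exact le_abs.1 (Set.mem_ofPred_eq ▸ hz)
  refine (measure_mono hset).trans ((measure_union_le _ _).trans ?_)
  rw [two_mul, ENNReal.ofReal_add (Real.exp_pos _).le (Real.exp_pos _).le, ← ofReal_measureReal,
    ← ofReal_measureReal]
  refine add_le_add (ENNReal.ofReal_le_ofReal ?_) (ENNReal.ofReal_le_ofReal ?_)
  · refine h1.trans_eq ?_
    simp
  · refine h2.trans_eq ?_
    simp

theorem pi_exists_le {ι Ω : Type*} [Fintype ι] [MeasurableSpace Ω] (P : Measure Ω)
    [IsProbabilityMeasure P] {s : Set Ω} {ε : ℝ}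
    (h : P s ≤ ENNReal.ofReal ε) :
    (Measure.pi fun _ : ι => P) {z | ∃ i, z i ∈ s} ≤ ENNReal.ofReal (Fintype.card ι * ε) := by
  have : {z : ι → Ω | ∃ i, z i ∈ s} = ⋃ i, Function.eval i ⁻¹' s := by ext; simp
  rw [this]
  refine (measure_iUnion_fintype_le _ _).trans ?_
  calc ∑ i : ι, (Measure.pi fun _ : ι => P) (Function.eval i ⁻¹' s)
      ≤ ∑ _i : ι, ENNReal.ofReal ε := Finset.sum_le_sum fun i _ =>
        ((measurePreserving_eval (fun _ : ι => P) i).measure_preimage_le s).trans h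
    _ = _ := by
      rw [Finset.sum_const, Finset.card_univ, nsmul_eq_mul, ENNReal.ofReal_mul (by positivity)]
      simp

theorem sign_hasSubgaussianMGF :
    HasSubgaussianMGF (fun b : Bool => (sign b : ℝ)) 1 (PMF.uniformOfFintype Bool).toMeasure := by
  have h := hasSubgaussianMGF_of_mem_Icc_of_integral_eq_zero (a := -1) (b := 1)
    (X := fun b : Bool => (sign b : ℝ)) (μ := (PMF.uniformOfFintype Bool).toMeasure)
    (Measurable.of_discrete.aemeasurable)
    (Filter.Eventually.of_forall fun b => by cases b <;> simp [sign]) (by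
      rw [PMF.integral_eq_sum]; simp [sign])
  convert h
  ext; norm_num

theorem rademacher_tail {D : ℕ} (a : Fin D → ℝ) {t : ℝ} (ht : 0 ≤ t) :
    (Measure.pi fun _ : Fin D => (PMF.uniformOfFintype Bool).toMeasure)
      {s | √(∑ k, a k ^ 2) * √(2 * t) < |∑ k, a k * (sign (s k) : ℝ)|} ≤
      ENNReal.ofReal (2 * Real.exp (-t)) := by
  set P := Measure.pi fun _ : Fin D => (PMF.uniformOfFintype Bool).toMeasure
  rcases eq_or_ne (∑ k, a k ^ 2) 0 with h0 | h0
  -- The sub-Gaussian exponent divides by the sum of squares. When that sum is zero, the strict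
  -- inequality makes the event empty.
  · have ha : ∀ k, a k = 0 := by
      intro k
      have := (Finset.sum_eq_zero_iff_of_nonneg fun k _ => sq_nonneg (a k)).1 h0 k (Finset.mem_univ _)
      simpa using this
    simp [ha]
  have hpos : 0 < ∑ k, a k ^ 2 := lt_of_le_of_ne (Finset.sum_nonneg fun _ _ => sq_nonneg _) h0.symm
  have hind : iIndepFun (fun k (s : Fin D → Bool) => a k * (sign (s k) : ℝ)) P :=
    iIndepFun_pi (X := fun k (b : Bool) => a k * (sign b : ℝ))
      fun k => (Measurable.of_discrete).aemeasurable
  have hsg : ∀ k, HasSubgaussianMGF (fun s : Fin D → Bool => a k * (sign (s k) : ℝ))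
      (‖a k‖₊ ^ 2) P := by
    intro k
    have hm := measurePreserving_eval
      (fun _ : Fin D => (PMF.uniformOfFintype Bool).toMeasure) k
    have := sign_hasSubgaussianMGF
    rw [← hm.map_eq] at this
    simpa using hasSubgaussianMGF_const_mul_nnnorm
      (HasSubgaussianMGF.of_map (Y := Function.eval k) hm.measurable.aemeasurable this) (a k)
  have hsum := HasSubgaussianMGF.sum_of_iIndepFun hind (s := Finset.univ) fun k _ => hsg k
  have hc : ((∑ k, ‖a k‖₊ ^ 2 : NNReal) : ℝ) = ∑ k, a k ^ 2 := by
    push_cast; simp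
  have he : 0 ≤ √(∑ k, a k ^ 2) * √(2 * t) := by positivity
  have h1 := hsum.measure_ge_le he
  have h2 := hsum.neg.measure_ge_le he
  have hexp : -(√(∑ k, a k ^ 2) * √(2 * t)) ^ 2 /
      (2 * ((∑ k, ‖a k‖₊ ^ 2 : NNReal) : ℝ)) = -t := by
    rw [hc, mul_pow, Real.sq_sqrt hpos.le, Real.sq_sqrt (by positivity)]
    field_simp
  rw [hexp] at h1 h2
  refine (measure_mono (t := {s | √(∑ k, a k ^ 2) * √(2 * t) ≤ ∑ k, a k * (sign (s k) : ℝ)} ∪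
    {s | √(∑ k, a k ^ 2) * √(2 * t) ≤ (-fun s : Fin D → Bool =>
      ∑ k, a k * (sign (s k) : ℝ)) s}) ?_).trans ((measure_union_le _ _).trans ?_)
  · intro s hs
    rw [Set.mem_ofPred_eq] at hs
    exact le_abs.1 hs.le
  · rw [two_mul (Real.exp _), ENNReal.ofReal_add (Real.exp_pos _).le (Real.exp_pos _).le,
      ← ofReal_measureReal, ← ofReal_measureReal]
    exact add_le_add (ENNReal.ofReal_le_ofReal h1) (ENNReal.ofReal_le_ofReal h2)

/-! ### Accuracy of the noisy binary search -/

/-- The loop invariant: fewer than `m + e` points lie below `left` unless `left` never moved, and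
more than `m - e` lie in `[0, right]` unless `right` never moved. A comparison with noise below `e`
preserves both halves, and `right - left + 1 ≤ 2 ^ N` ensures that the remaining iterations close
the interval. -/
theorem privQuantLoop_spec {n : ℕ} (x : Fin n → ℤ) {m s e : ℝ} {U : ℕ} :
    ∀ (N : ℕ) (z : Fin N → ℝ) (left right : ℕ), (∀ t, |s * z t| < e) → left ≤ right →
      right ≤ U → right - left + 1 ≤ 2 ^ N →
      (left = 0 ∨ (rangeCount x (left - 1) : ℝ) < m + e) →
      (right = U ∨ m - e < (rangeCount x right : ℝ)) →
      privQuantLoop x m s N z left right ≤ U ∧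
      (privQuantLoop x m s N z left right = 0 ∨
        (rangeCount x (privQuantLoop x m s N z left right - 1) : ℝ) < m + e) ∧
      (privQuantLoop x m s N z left right = U ∨
        m - e < (rangeCount x (privQuantLoop x m s N z left right) : ℝ)) := by
  intro N
  induction N with
  | zero =>
    intro z left right _ hlr hU hN hl hr
    -- With no iterations left, `2 ^ 0 = 1` forces the interval to be a single point.
    obtain rfl : left = right := by simp at hN; omega
    have : (left + left) / 2 = left := by omega
    simp only [privQuantLoop, this]
    exact ⟨hU, hl, hr⟩
  | succ N ih =>
    intro z left right hz hlr hU hN hl hr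
    rw [pow_succ] at hN
    have h0 := abs_lt.1 (hz 0)
    rw [privQuantLoop]
    split_ifs with h1 h2
    · refine ih _ _ _ (fun t => hz t.succ) (by omega) hU (by omega) (Or.inr ?_) hr
      rw [Nat.add_sub_cancel]
      linarith
    · refine ih _ _ _ (fun t => hz t.succ) (by omega) (by omega) (by omega) hl (Or.inr ?_)
      linarith
    · obtain rfl : left = right := by omega
      have : (left + left) / 2 = left := by omega
      rw [this]
      exact ⟨hU, hl, hr⟩

theorem privQuant_spec {n : ℕ} (x : Fin n → ℤ) (U : ℕ) {m ρ e : ℝ} (z : Fin (rounds U) → ℝ)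
    (hz : ∀ t, |√((rounds U : ℝ) / (2 * ρ)) * z t| < e) :
    privQuant x U m ρ z ≤ U ∧
      (privQuant x U m ρ z = 0 ∨ (rangeCount x (privQuant x U m ρ z - 1) : ℝ) < m + e) ∧
      (privQuant x U m ρ z = U ∨ m - e < (rangeCount x (privQuant x U m ρ z) : ℝ)) :=
  privQuantLoop_spec x (rounds U) z 0 U hz (Nat.zero_le _) le_rfl
    (by simpa [rounds] using Nat.le_pow_clog one_lt_two (U + 1)) (Or.inl rfl) (Or.inl rfl)

theorem rangeCount_of_nonneg {n : ℕ} {x : Fin n → ℤ} (hx : ∀ i, 0 ≤ x i) (v : ℕ) :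
    rangeCount x v = (Finset.univ.filter fun i => x i ≤ (v : ℤ)).card := by
  simp [rangeCount, hx]

theorem exists_gt_of_rangeCount_lt {n : ℕ} {x : Fin n → ℤ} (hx : ∀ i, 0 ≤ x i) {v : ℕ}
    (h : rangeCount x v < n) : ∃ i, (v : ℤ) < x i := by
  by_contra! hc
  rw [rangeCount_of_nonneg hx, Finset.filter_true_of_mem fun i _ => hc i] at h
  simp at h

theorem exists_le_of_rangeCount_pos {n : ℕ} {x : Fin n → ℤ} {v : ℕ}
    (h : 0 < rangeCount x v) : ∃ i, x i ≤ (v : ℤ) := by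
  obtain ⟨i, hi⟩ := Finset.card_pos.1 h
  exact ⟨i, (Finset.mem_filter.1 hi).2.2⟩

/-- Fewer than `m + e ≤ n` points lie strictly below the output, so some point does not. With
`le_privQuant_exists` at `m = e = n/2`, this traps the output between the extremes of the data. -/
theorem privQuant_le_exists {n : ℕ} (hn : 0 < n) {x : Fin n → ℤ} {U : ℕ} (hx : ∀ i, 0 ≤ x i)
    {m ρ e : ℝ} {z : Fin (rounds U) → ℝ}
    (hz : ∀ t, |√((rounds U : ℝ) / (2 * ρ)) * z t| < e) (hme : m + e ≤ n) :
    ∃ i, (privQuant x U m ρ z : ℤ) ≤ x i := by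
  obtain ⟨-, h | h, -⟩ := privQuant_spec x U (m := m) z hz
  · exact ⟨⟨0, hn⟩, by rw [h]; exact hx _⟩
  · have h' : rangeCount x (privQuant x U m ρ z - 1) < n := by exact_mod_cast h.trans_le hme
    obtain ⟨i, hi⟩ := exists_gt_of_rangeCount_lt hx h'
    exact ⟨i, by omega⟩

theorem le_privQuant_exists {n : ℕ} (hn : 0 < n) {x : Fin n → ℤ} {U : ℕ}
    (hxU : ∀ i, x i ≤ U) {m ρ e : ℝ} {z : Fin (rounds U) → ℝ}
    (hz : ∀ t, |√((rounds U : ℝ) / (2 * ρ)) * z t| < e) (hme : e ≤ m) :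
    ∃ i, x i ≤ (privQuant x U m ρ z : ℤ) := by
  obtain ⟨-, -, h | h⟩ := privQuant_spec x U (m := m) z hz
  · exact ⟨⟨0, hn⟩, by rw [h]; exact hxU _⟩
  · refine exists_le_of_rangeCount_pos ?_
    have : (0 : ℝ) < rangeCount x (privQuant x U m ρ z) := by linarith
    exact_mod_cast this

theorem card_gt_privQuant_le {n : ℕ} {x : Fin n → ℤ} {U : ℕ} (hx : ∀ i, 0 ≤ x i)
    (hxU : ∀ i, x i ≤ U) {m ρ e : ℝ} {z : Fin (rounds U) → ℝ}
    (hz : ∀ t, |√((rounds U : ℝ) / (2 * ρ)) * z t| < e) (hme : m - e ≤ n) :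
    ((Finset.univ.filter fun i => (privQuant x U m ρ z : ℤ) < x i).card : ℝ) ≤ n - (m - e) := by
  obtain ⟨-, -, h | h⟩ := privQuant_spec x U (m := m) z hz
  · rw [Finset.filter_false_of_mem fun i _ => by rw [h]; exact not_lt.2 (hxU i)]
    simp; linarith
  · rw [rangeCount_of_nonneg hx] at h
    have := Finset.card_filter_add_card_filter_not (s := (Finset.univ : Finset (Fin n)))
      (fun i => x i ≤ (privQuant x U m ρ z : ℤ))
    simp only [not_le, Finset.card_univ, Fintype.card_fin] at this
    have h2 : ((Finset.univ.filter fun i => x i ≤ (privQuant x U m ρ z : ℤ)).card : ℝ) +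
      ((Finset.univ.filter fun i => (privQuant x U m ρ z : ℤ) < x i).card : ℝ) = n := by
      exact_mod_cast this
    linarith

/-! ### Error of the clipped mean -/

theorem norm_clip_sub_le {D : ℕ} {C : ℝ} (hC : 0 ≤ C) (x : EuclideanSpace ℝ (Fin D)) :
    ‖clip C x - x‖ ≤ ‖x‖ := by
  have h0 : 0 ≤ min (C / ‖x‖) 1 := le_min (by positivity) zero_le_one
  have h1 : min (C / ‖x‖) 1 ≤ 1 := min_le_right _ _
  have : clip C x - x = (min (C / ‖x‖) 1 - 1) • x := by rw [clip, sub_smul, one_smul]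
  rw [this, norm_smul, Real.norm_eq_abs, abs_of_nonpos (by linarith)]
  exact mul_le_of_le_one_left (norm_nonneg _) (by linarith)

theorem clip_eq_self {D : ℕ} {C : ℝ} {x : EuclideanSpace ℝ (Fin D)} (h : ‖x‖ ≤ C) :
    clip C x = x := by
  rcases eq_or_ne x 0 with rfl | hx
  · simp [clip]
  · have : 0 < ‖x‖ := norm_pos_iff.2 hx
    rw [clip, min_eq_right ((one_le_div this).2 h), one_smul]

/-- Only the points of norm above `C`, at most `k` of them, are moved, each by at most its norm. The
noise scale is `√(2/ρ) C / n`, and `C ≤ Γ`. -/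
theorem norm_clippedMean_sub_le {n D : ℕ} (x : Fin n → EuclideanSpace ℝ (Fin D)) {C ρ Γ k : ℝ}
    (hC : 0 ≤ C) (hCΓ : C ≤ Γ) (hρ : 0 < ρ) (hx : ∀ i, ‖x i‖ ≤ Γ)
    (hk : ((Finset.univ.filter fun i => C < ‖x i‖).card : ℝ) ≤ k) (z : EuclideanSpace ℝ (Fin D)) :
    ‖clippedMean x C ρ z - (1 / (n : ℝ)) • ∑ i, x i‖ ≤ (k + √(2 / ρ) * ‖z‖) * Γ / n := by
  have hΓ : 0 ≤ Γ := hC.trans hCΓ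
  have h1 : clippedMean x C ρ z - (1 / (n : ℝ)) • ∑ i, x i =
      (1 / (n : ℝ)) • ∑ i, (clip C (x i) - x i) + √(2 * C ^ 2 / (ρ * (n : ℝ) ^ 2)) • z := by
    rw [clippedMean, Finset.sum_sub_distrib, smul_sub]; abel
  have h2 : ‖∑ i, (clip C (x i) - x i)‖ ≤ k * Γ := by
    calc ‖∑ i, (clip C (x i) - x i)‖ ≤ ∑ i, ‖clip C (x i) - x i‖ := norm_sum_le _ _
      _ ≤ ∑ i, if C < ‖x i‖ then Γ else 0 := by
        refine Finset.sum_le_sum fun i _ => ?_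
        split_ifs with h
        · exact (norm_clip_sub_le hC _).trans (hx i)
        · rw [clip_eq_self (not_lt.1 h)]; simp
      _ = (Finset.univ.filter fun i => C < ‖x i‖).card * Γ := by
        rw [← Finset.sum_filter, Finset.sum_const, nsmul_eq_mul]
      _ ≤ k * Γ := by gcongr
  have h3 : √(2 * C ^ 2 / (ρ * (n : ℝ) ^ 2)) = √(2 / ρ) * C / n := by
    rw [show 2 * C ^ 2 / (ρ * (n : ℝ) ^ 2) = (2 / ρ) * (C / n) ^ 2 by
      rw [div_pow, div_mul_div_comm], Real.sqrt_mul (by positivity),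
      Real.sqrt_sq (by positivity), mul_div_assoc]
  rw [h1]
  refine (norm_add_le _ _).trans ?_
  rw [norm_smul, norm_smul, h3, Real.norm_of_nonneg (by positivity),
    Real.norm_of_nonneg (by positivity)]
  calc 1 / (n : ℝ) * ‖∑ i, (clip C (x i) - x i)‖ + √(2 / ρ) * C / n * ‖z‖
      ≤ 1 / (n : ℝ) * (k * Γ) + √(2 / ρ) * Γ / n * ‖z‖ := by gcongr
    _ = _ := by ring

theorem norm_toEuc_sq {D : ℕ} (v : Fin D → ℤ) : ‖toEuc v‖ ^ 2 = ((∑ j, v j ^ 2 : ℤ) : ℝ) := by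
  rw [EuclideanSpace.real_norm_sq_eq]; simp [toEuc]

/-- The number of points that the clipped-mean estimator aims to clip. -/
noncomputable def trimCount (D u : ℕ) (ρ β : ℝ) : ℝ :=
  max (√(2 * (D : ℝ) / ρ)) (rankErr (D * u ^ 2) (ρ / 4) β)

/-- The target rank `n - t` is lowered by at least the rank error `e ≤ t`. Hence `(n - t) + e ≤ n`
keeps the threshold below the largest norm, and `(n - t) - e ≥ n - 2t` bounds the number of clipped
points by `2t`. -/
theorem norm_adaptiveClippedMean_sub_le {n D : ℕ} (hn : 2 ≤ n) (x : Fin n → Fin D → ℤ) {u : ℕ}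
    {ρ β Γ : ℝ} (hρ : 0 < ρ) (hu : ∀ i j, |x i j| ≤ u) (hx : ∀ i, ‖toEuc (x i)‖ ≤ Γ)
    (ht : trimCount D u ρ β ≤ n / 2) {zq : Fin (rounds (D * u ^ 2)) → ℝ}
    (hzq : ∀ t, |√((rounds (D * u ^ 2) : ℝ) / (2 * (ρ / 4))) * zq t| <
      rankErr (D * u ^ 2) (ρ / 4) β)
    (z : EuclideanSpace ℝ (Fin D)) :
    ‖adaptiveClippedMean x u ρ β zq z - (1 / (n : ℝ)) • ∑ i, toEuc (x i)‖ ≤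
      (2 * trimCount D u ρ β + √(2 / (3 / 4 * ρ)) * ‖z‖) * Γ / n := by
  have hn' : (2 : ℝ) ≤ n := by exact_mod_cast hn
  set t := trimCount D u ρ β with ht_def
  have hτt : rankErr (D * u ^ 2) (ρ / 4) β ≤ t := le_max_right _ _
  rw [adaptiveClippedMean]
  simp only
  -- Since `t ≤ n/2` and `n ≥ 2`, the zero output is not taken and `n - t ≥ 1`.
  rw [show max (√(2 * (D : ℝ) / ρ)) (rankErr (D * u ^ 2) (ρ / 4) β) = t from rfl,
    if_neg (by linarith), max_eq_left (by linarith)]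
  set y : Fin n → ℤ := fun i => ∑ j, x i j ^ 2 with hy
  have hy0 : ∀ i, 0 ≤ y i := fun i => Finset.sum_nonneg fun j _ => sq_nonneg _
  have hyU : ∀ i, y i ≤ ((D * u ^ 2 : ℕ) : ℤ) := by
    intro i
    calc y i ≤ ∑ _j : Fin D, (u : ℤ) ^ 2 := Finset.sum_le_sum fun j _ => by
          rw [← sq_abs]; exact pow_le_pow_left₀ (abs_nonneg _) (hu i j) 2
      _ = _ := by simp
  have hyn : ∀ i, ‖toEuc (x i)‖ = √(y i : ℝ) := fun i => by
    rw [hy, ← norm_toEuc_sq, Real.sqrt_sq (norm_nonneg _)]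
  set v := privQuant y (D * u ^ 2) ((n : ℝ) - t) (ρ / 4) zq with hv
  obtain ⟨i, hi⟩ := privQuant_le_exists (by omega : 0 < n) hy0 (m := (n : ℝ) - t) hzq (by linarith)
  have hcard := card_gt_privQuant_le hy0 hyU (m := (n : ℝ) - t) hzq (by
    have := (Real.sqrt_nonneg _).trans (le_max_left (√(2 * (D : ℝ) / ρ))
      (rankErr (D * u ^ 2) (ρ / 4) β))
    have : 0 ≤ rankErr (D * u ^ 2) (ρ / 4) β := Real.sqrt_nonneg _
    linarith)
  rw [← hv] at hi hcard
  refine norm_clippedMean_sub_le _ (Real.sqrt_nonneg _) ?_ (by positivity) hx ?_ z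
  · refine le_trans ?_ (hx i)
    rw [hyn]
    exact Real.sqrt_le_sqrt (by exact_mod_cast hi)
  · have hset : (Finset.univ.filter fun i => √(v : ℝ) < ‖toEuc (x i)‖) =
        Finset.univ.filter fun i => (v : ℤ) < y i := by
      ext i
      simp only [Finset.mem_filter, Finset.mem_univ, true_and]
      rw [hyn, Real.sqrt_lt_sqrt_iff (by positivity)]
      exact_mod_cast Iff.rfl
    rw [hset]
    linarith

/-! ### The random rotation -/

theorem hadamard_sq {k : ℕ} (i j : Fin (2 ^ k)) : hadamard k i j ^ 2 = 1 := by
  have := (isHadamard_hadamard k).1 i j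
  rw [Unitary.mem_iff] at this
  simpa [sq] using this.1

theorem sign_sq (b : Bool) : sign b ^ 2 = 1 := by cases b <;> simp [sign]

theorem rotation_apply {k : ℕ} (s : Fin (2 ^ k) → Bool) (i j : Fin (2 ^ k)) :
    rotation s i j = hadamard k i j * sign (s j) := by
  simp [rotation]

theorem abs_rotation {k : ℕ} (s : Fin (2 ^ k) → Bool) (i j : Fin (2 ^ k)) :
    |rotation s i j| = 1 := by
  rw [← sq_eq_sq₀ (abs_nonneg _) zero_le_one, sq_abs, rotation_apply, mul_pow, hadamard_sq, sign_sq]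
  simp

theorem rotation_mul_transpose {k : ℕ} (s : Fin (2 ^ k) → Bool) :
    rotation s * (rotation s)ᵀ = (2 ^ k : ℤ) • (1 : Matrix (Fin (2 ^ k)) (Fin (2 ^ k)) ℤ) := by
  have h := (isHadamard_hadamard k).2
  have hs : (Matrix.diagonal fun j => sign (s j)) * (Matrix.diagonal fun j => sign (s j)) =
      (1 : Matrix (Fin (2 ^ k)) (Fin (2 ^ k)) ℤ) := by
    rw [Matrix.diagonal_mul_diagonal]
    simp [← sq, sign_sq]
  rw [rotation, Matrix.transpose_mul, Matrix.diagonal_transpose, Matrix.mul_assoc,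
    ← Matrix.mul_assoc (Matrix.diagonal _), hs, Matrix.one_mul]
  simpa using h

/-- The normalized rotation is orthogonal, so undoing it preserves distances; one factor `1/√D`
survives because the argument is rescaled as well. -/
theorem norm_inv_rotation_apply {k : ℕ} (s : Fin (2 ^ k) → Bool)
    (v q : EuclideanSpace ℝ (Fin (2 ^ k))) :
    ‖Matrix.toEuclideanCLM (𝕜 := ℝ)
        ((1 / √((2 : ℝ) ^ k)) • (rotation s).map (Int.cast : ℤ → ℝ))⁻¹
        ((1 / √((2 : ℝ) ^ k)) • v) - q‖ =
      (1 / √((2 : ℝ) ^ k)) *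
        ‖v - Matrix.toEuclideanCLM (𝕜 := ℝ) ((rotation s).map (Int.cast : ℤ → ℝ)) q‖ := by
  set r : ℝ := 1 / √((2 : ℝ) ^ k) with hr
  set A : Matrix (Fin (2 ^ k)) (Fin (2 ^ k)) ℝ := (rotation s).map (Int.cast : ℤ → ℝ) with hA
  have hrr : r * r * 2 ^ k = 1 := by
    have : (0 : ℝ) < 2 ^ k := by positivity
    rw [hr, div_mul_div_comm, Real.mul_self_sqrt this.le]
    field_simp
  have hAA : A * Aᵀ = (2 ^ k : ℝ) • (1 : Matrix (Fin (2 ^ k)) (Fin (2 ^ k)) ℝ) := by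
    have h := congrArg (fun B : Matrix (Fin (2 ^ k)) (Fin (2 ^ k)) ℤ =>
      B.map (Int.castRingHom ℝ)) (rotation_mul_transpose s)
    simp only [Matrix.map_mul] at h
    rw [hA]
    refine Eq.trans h ?_
    ext i j
    rw [Matrix.map_apply, Matrix.smul_apply, Matrix.smul_apply, Matrix.one_apply, Matrix.one_apply]
    split_ifs <;> simp
  have hM : (r • A) * (r • A)ᵀ = 1 := by
    rw [Matrix.transpose_smul, Matrix.smul_mul, Matrix.mul_smul, hAA, smul_smul, smul_smul, hrr,
      one_smul]
  have hM' : (r • A)ᵀ * (r • A) = 1 := mul_eq_one_comm.1 hM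
  rw [Matrix.inv_eq_right_inv hM]
  have hiso : ∀ w, ‖Matrix.toEuclideanCLM (𝕜 := ℝ) (r • A)ᵀ w‖ = ‖w‖ := by
    rw [ContinuousLinearMap.norm_map_iff_adjoint_comp_self, ← ContinuousLinearMap.star_eq_adjoint,
      ← ContinuousLinearMap.mul_def, ← map_star, ← map_mul, Matrix.star_eq_conjTranspose,
      Matrix.conjTranspose_eq_transpose_of_trivial, Matrix.transpose_transpose, hM, map_one]
  have hq : q = Matrix.toEuclideanCLM (𝕜 := ℝ) (r • A)ᵀ
      (r • Matrix.toEuclideanCLM (𝕜 := ℝ) A q) := by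
    rw [← _root_.smul_apply, ← map_smul, ← mul_apply_eq_comp, ← map_mul,
      hM', map_one]
    rfl
  conv_lhs => rw [hq]
  rw [← map_sub, ← smul_sub, hiso, norm_smul, Real.norm_of_nonneg (by positivity)]

theorem toEuclideanCLM_rotation_toEuc {k : ℕ} (s : Fin (2 ^ k) → Bool) (x : Fin (2 ^ k) → ℤ) :
    Matrix.toEuclideanCLM (𝕜 := ℝ) ((rotation s).map (Int.cast : ℤ → ℝ)) (toEuc x) =
      toEuc (rotation s *ᵥ x) := by
  ext j
  simp [toEuc, Matrix.mulVec, dotProduct]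

theorem abs_rotation_mulVec_le {k : ℕ} (s : Fin (2 ^ k) → Bool) {x : Fin (2 ^ k) → ℤ} {U : ℕ}
    (hx : ∀ j, 0 ≤ x j ∧ x j ≤ U) (j : Fin (2 ^ k)) :
    |(rotation s *ᵥ x) j| ≤ ((2 ^ k * U : ℕ) : ℤ) := by
  rw [Matrix.mulVec, dotProduct]
  refine (Finset.abs_sum_le_sum_abs _ _).trans ?_
  calc ∑ l, |rotation s j l * x l| ≤ ∑ _l : Fin (2 ^ k), (U : ℤ) :=
        Finset.sum_le_sum fun l _ => by
          rw [abs_mul, abs_rotation, one_mul, abs_of_nonneg (hx l).1]; exact (hx l).2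
    _ = _ := by simp

/-! ### Error of the shifted-clipped-mean estimator -/

/-- No accuracy as a median is needed, only membership in the range of the data, so noise up to
`n/2` is tolerated. -/
theorem privCenter_mem_hull {n D : ℕ} (hn : 0 < n) {x : Fin n → Fin D → ℤ} {B : ℕ} {ρ : ℝ}
    (hx : ∀ i j, |x i j| ≤ B) {z : Fin D → Fin (rounds (2 * B)) → ℝ}
    (hz : ∀ j t, |√((rounds (2 * B) : ℝ) / (2 * (ρ / (4 * (D : ℝ))))) * z j t| < (n : ℝ) / 2)
    (j : Fin D) :
    (∃ i, privCenter x B ρ z j ≤ x i j) ∧ ∃ i, x i j ≤ privCenter x B ρ z j := by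
  have h0 : ∀ i, 0 ≤ x i j + (B : ℤ) := fun i => by have := (abs_le.1 (hx i j)).1; omega
  have h1 : ∀ i, x i j + (B : ℤ) ≤ ((2 * B : ℕ) : ℤ) := fun i => by
    have := (abs_le.1 (hx i j)).2; push_cast; omega
  obtain ⟨i, hi⟩ := privQuant_le_exists hn h0 (m := (n : ℝ) / 2) (hz j) (by linarith)
  obtain ⟨i', hi'⟩ := le_privQuant_exists hn h1 (m := (n : ℝ) / 2) (hz j) le_rfl
  exact ⟨⟨i, by rw [privCenter]; omega⟩, ⟨i', by rw [privCenter]; omega⟩⟩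

/-- All rotated points are within `G` of the rotated `w` in every coordinate, hence so is a centre
lying between them. Shifted coordinates are therefore at most `2G` and shifted norms at most `√D ·
2G`. -/
theorem norm_shiftedClippedMean_sub_le {n k : ℕ} (hn : 2 ≤ n) {x : Fin n → Fin (2 ^ k) → ℤ} {U : ℕ}
    {ρ β G : ℝ} (hρ : 0 < ρ) (hx : ∀ i j, 0 ≤ x i j ∧ x i j ≤ U)
    {ω : Noise (2 ^ k) U} (w : Fin (2 ^ k) → ℝ)
    (hG : ∀ i j, |∑ l, (hadamard k j l : ℝ) * ((x i l : ℝ) - w l) * (sign (ω.1 l) : ℝ)| ≤ G)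
    (hmed : ∀ j t, |√((rounds (2 * (2 ^ k * U)) : ℝ) / (2 * (ρ / (4 * ((2 ^ k : ℕ) : ℝ))))) *
      ω.2.1 j t| < (n : ℝ) / 2)
    (ht : trimCount (2 ^ k) (2 * (2 ^ k * U)) (3 / 4 * ρ) (β / 3) ≤ n / 2)
    (hthr : ∀ t, |√((rounds (2 ^ k * (2 * (2 ^ k * U)) ^ 2) : ℝ) / (2 * (3 / 4 * ρ / 4))) *
      ω.2.2.1 t| < rankErr (2 ^ k * (2 * (2 ^ k * U)) ^ 2) (3 / 4 * ρ / 4) (β / 3)) :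
    ‖shiftedClippedMean x U ρ β ω - (1 / (n : ℝ)) • ∑ i, toEuc (x i)‖ ≤
      (2 * trimCount (2 ^ k) (2 * (2 ^ k * U)) (3 / 4 * ρ) (β / 3) +
        √(2 / (3 / 4 * (3 / 4 * ρ))) * ‖ω.2.2.2‖) * (2 * G) / n := by
  have hn0 : (n : ℝ) ≠ 0 := by positivity
  rw [shiftedClippedMean]
  simp only
  set xh : Fin n → Fin (2 ^ k) → ℤ := fun i => rotation ω.1 *ᵥ x i with hxh
  have hxhB : ∀ i j, |xh i j| ≤ ((2 ^ k * U : ℕ) : ℤ) := fun i j =>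
    abs_rotation_mulVec_le ω.1 (hx i) j
  set c := privCenter xh (2 ^ k * U) ρ ω.2.1 with hc
  have hhull := fun j => privCenter_mem_hull (by omega : 0 < n) hxhB hmed j
  rw [← hc] at hhull
  have hGd : ∀ i j, |(xh i j : ℝ) - ∑ l, (rotation ω.1 j l : ℝ) * w l| ≤ G := by
    intro i j
    refine le_trans (le_of_eq ?_) (hG i j)
    congr 1
    simp only [hxh, Matrix.mulVec, dotProduct, Int.cast_sum, Int.cast_mul, rotation_apply,
      ← Finset.sum_sub_distrib]
    exact Finset.sum_congr rfl fun l _ => by ring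
  have hdiff : ∀ i j, |((xh i - c) j : ℝ)| ≤ 2 * G := by
    intro i j
    obtain ⟨⟨i₁, h₁⟩, ⟨i₂, h₂⟩⟩ := hhull j
    have h₁' : (c j : ℝ) ≤ xh i₁ j := by exact_mod_cast h₁
    have h₂' : (xh i₂ j : ℝ) ≤ c j := by exact_mod_cast h₂
    have e := abs_le.1 (hGd i j)
    have e₁ := abs_le.1 (hGd i₁ j)
    have e₂ := abs_le.1 (hGd i₂ j)
    rw [Pi.sub_apply, Int.cast_sub]
    exact abs_le.2 ⟨by linarith, by linarith⟩
  have hG0 : 0 ≤ G := by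
    have := (abs_nonneg _).trans (hG ⟨0, by omega⟩ ⟨0, by positivity⟩)
    exact this
  have hu : ∀ i j, |(xh i - c) j| ≤ ((2 * (2 ^ k * U) : ℕ) : ℤ) := by
    intro i j
    obtain ⟨⟨i₁, h₁⟩, ⟨i₂, h₂⟩⟩ := hhull j
    have e := abs_le.1 (hxhB i j)
    have e₁ := abs_le.1 (hxhB i₁ j)
    have e₂ := abs_le.1 (hxhB i₂ j)
    rw [Pi.sub_apply, abs_le]
    push_cast at *
    constructor <;> linarith
  have hnorm : ∀ i, ‖toEuc (xh i - c)‖ ≤ √((2 : ℝ) ^ k) * (2 * G) := by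
    intro i
    rw [← sq_le_sq₀ (norm_nonneg _) (by positivity), EuclideanSpace.real_norm_sq_eq, mul_pow,
      Real.sq_sqrt (by positivity)]
    calc ∑ j, (toEuc (xh i - c)) j ^ 2 ≤ ∑ _j : Fin (2 ^ k), (2 * G) ^ 2 :=
          Finset.sum_le_sum fun j _ => sq_le_sq' (abs_le.1 (hdiff i j)).1 (abs_le.1 (hdiff i j)).2
      _ = _ := by simp
  have hmean := norm_adaptiveClippedMean_sub_le hn (fun i => xh i - c) (by positivity) hu hnorm
    ht hthr ω.2.2.2
  -- By linearity the shift cancels exactly, leaving only the error of the clipped mean.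
  have hAq : Matrix.toEuclideanCLM (𝕜 := ℝ) ((rotation ω.1).map (Int.cast : ℤ → ℝ))
      ((1 / (n : ℝ)) • ∑ i, toEuc (x i)) = (1 / (n : ℝ)) • ∑ i, toEuc (xh i - c) + toEuc c := by
    have : ∀ i, toEuc (xh i - c) = toEuc (xh i) - toEuc c := fun i => by
      ext j; simp [toEuc]
    rw [map_smul, map_sum]
    simp only [toEuclideanCLM_rotation_toEuc, this, Finset.sum_sub_distrib, smul_sub,
      Finset.sum_const, Finset.card_univ, Fintype.card_fin]
    rw [← Nat.cast_smul_eq_nsmul ℝ, smul_smul, one_div, inv_mul_cancel₀ hn0, one_smul]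
    abel
  rw [norm_inv_rotation_apply, hAq, add_sub_add_right_eq_sub]
  have h2k : (0 : ℝ) < √((2 : ℝ) ^ k) := by positivity
  -- The `1/√D` of the inverse rotation cancels the `√D` in the norm bound.
  refine (mul_le_mul_of_nonneg_left hmean (by positivity)).trans (le_of_eq ?_)
  field_simp

/-! ### Quantization and padding -/

theorem sum_castLE_padExp {d : ℕ} (f : Fin (2 ^ padExp d) → ℝ) :
    ∑ j : Fin d, f (Fin.castLE (le_two_pow_padExp d) j) =
      ∑ l ∈ Finset.univ.map (Fin.castLEEmb (le_two_pow_padExp d)), f l :=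
  (Finset.sum_map Finset.univ (Fin.castLEEmb (le_two_pow_padExp d)) f).symm

theorem sum_pad {d : ℕ} (f : Fin (2 ^ padExp d) → ℝ) (hf : ∀ l, d ≤ l.val → f l = 0) :
    ∑ l, f l = ∑ j : Fin d, f (Fin.castLE (le_two_pow_padExp d) j) := by
  rw [sum_castLE_padExp]
  refine (Finset.sum_subset (Finset.subset_univ _) fun l _ hl => hf l ?_).symm
  by_contra! h
  exact hl (Finset.mem_map.2 ⟨⟨l, h⟩, Finset.mem_univ _, rfl⟩)

theorem pad_castLE {d : ℕ} (v : Fin d → ℤ) (j : Fin d) :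
    pad v (Fin.castLE (le_two_pow_padExp d) j) = v j := by
  simp [pad]

/-- The image of `μ` in the coordinates of the quantized and padded data. -/
noncomputable def padCenter {d : ℕ} (R' b : ℝ) (μ : EuclideanSpace ℝ (Fin d)) :
    Fin (2 ^ padExp d) → ℝ :=
  fun j => if h : j.val < d then (μ ⟨j.val, h⟩ + R') / b else 0

theorem padCenter_castLE {d : ℕ} (R' b : ℝ) (μ : EuclideanSpace ℝ (Fin d)) (j : Fin d) :
    padCenter R' b μ (Fin.castLE (le_two_pow_padExp d) j) = (μ j + R') / b := by
  simp [padCenter]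

theorem abs_quantize_sub_le {d : ℕ} {R' b : ℝ} (hb : 0 < b) (x : EuclideanSpace ℝ (Fin d))
    (j : Fin d) : |b * (quantize R' b x j : ℝ) - R' - x j| ≤ b := by
  have h1 := Int.floor_le ((x j + R') / b)
  have h2 := Int.lt_floor_add_one ((x j + R') / b)
  rw [le_div_iff₀ hb] at h1
  rw [div_lt_iff₀ hb] at h2
  rw [quantize, abs_le]
  constructor <;> linarith

theorem abs_apply_le_norm {d : ℕ} (x : EuclideanSpace ℝ (Fin d)) (j : Fin d) : |x j| ≤ ‖x‖ := by
  simpa using PiLp.norm_apply_le x j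

theorem norm_le_sqrt_mul_of_abs_le {d : ℕ} {x : EuclideanSpace ℝ (Fin d)} {b : ℝ} (hb : 0 ≤ b)
    (h : ∀ j, |x j| ≤ b) : ‖x‖ ≤ √(d : ℝ) * b := by
  rw [← sq_le_sq₀ (norm_nonneg _) (by positivity), EuclideanSpace.real_norm_sq_eq, mul_pow,
    Real.sq_sqrt (by positivity)]
  calc ∑ j, x j ^ 2 ≤ ∑ _j : Fin d, b ^ 2 :=
        Finset.sum_le_sum fun j _ => sq_le_sq' (abs_le.1 (h j)).1 (abs_le.1 (h j)).2
    _ = _ := by simp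

theorem quantize_mem {d : ℕ} {R' b : ℝ} (hb : 0 < b) {x : EuclideanSpace ℝ (Fin d)}
    (hx : ‖x‖ ≤ R') (j : Fin d) :
    0 ≤ quantize R' b x j ∧ quantize R' b x j ≤ (⌊2 * R' / b⌋₊ : ℤ) := by
  have h := abs_le.1 ((abs_apply_le_norm x j).trans hx)
  have hR : 0 ≤ R' := (norm_nonneg _).trans hx
  refine ⟨Int.floor_nonneg.2 (div_nonneg (by linarith) hb.le), ?_⟩
  rw [Int.natCast_floor_eq_floor (by positivity)]
  exact Int.floor_le_floor (by gcongr; linarith)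

/-- Up to the scale `b`, the difference is `x - μ` plus a rounding error with coordinates at most
`b`; the padding contributes zero on both sides. -/
theorem sqrt_sum_pad_quantize_sub_le {d : ℕ} {R' b K : ℝ} (hb : 0 < b)
    {x μ : EuclideanSpace ℝ (Fin d)} (hx : ‖x - μ‖ ≤ K) :
    √(∑ l, ((pad (quantize R' b x) l : ℝ) - padCenter R' b μ l) ^ 2) ≤ (K + √(d : ℝ) * b) / b := by
  rw [sum_pad _ fun l hl => by simp [pad, padCenter, not_lt.2 hl]]
  simp only [pad_castLE, padCenter_castLE]
  set e : EuclideanSpace ℝ (Fin d) := WithLp.toLp 2 fun j => b * (quantize R' b x j : ℝ) - R' - x j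
  have he : ‖e‖ ≤ √(d : ℝ) * b := norm_le_sqrt_mul_of_abs_le hb.le fun j => abs_quantize_sub_le hb x j
  have hsum : ∑ j, ((quantize R' b x j : ℝ) - (μ j + R') / b) ^ 2 = (‖(x - μ) + e‖ / b) ^ 2 := by
    rw [div_pow, EuclideanSpace.real_norm_sq_eq, Finset.sum_div]
    refine Finset.sum_congr rfl fun j _ => ?_
    simp only [e, PiLp.add_apply, PiLp.sub_apply]
    field_simp
    ring
  rw [hsum, Real.sqrt_sq (by positivity)]
  gcongr
  exact (norm_add_le _ _).trans (add_le_add hx he)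

theorem bucket_eq {d n : ℕ} (hd : 1 ≤ d) (σmin : ℝ) : bucket d n σmin = σmin / √(n : ℝ) := by
  have : 0 < √(d : ℝ) := Real.sqrt_pos.2 (by exact_mod_cast hd)
  rw [bucket, Real.sqrt_div (by positivity)]
  field_simp

theorem univSize_eq {d n : ℕ} (hd : 1 ≤ d) (R σmin σmax β : ℝ) :
    univSize d n R σmin σmax β = 2 * clipRadius d n R σmax β / bucket d n σmin := by
  rw [bucket_eq hd, univSize, div_div_eq_mul_div]

/-- The error splits into the integer estimator's error (`V₁`), the rounding bias of the mean (`V₂`)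
and the sampling error. The spread is written `G / b` because integer coordinates count buckets;
undoing the quantization cancels `b`. -/
theorem norm_gaussianMeanEst_sub_le {n d : ℕ} (hd : 1 ≤ d) (hn : 2 ≤ n)
    {R σmin σmax ρ β G K : ℝ} (hσ : 0 < σmin) (hρ : 0 < ρ)
    {x : Fin n → EuclideanSpace ℝ (Fin d)} {μ : EuclideanSpace ℝ (Fin d)}
    {ω : Noise (2 ^ padExp d) (univMax d n R σmin σmax β)}
    (hx : ∀ i, ‖x i‖ ≤ clipRadius d n R σmax β)
    (hmean : ‖(1 / (n : ℝ)) • ∑ i, x i - μ‖ ≤ K)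
    (hG : ∀ i j, |∑ l, (hadamard (padExp d) j l : ℝ) *
      ((pad (quantize (clipRadius d n R σmax β) (bucket d n σmin)
        (clip (clipRadius d n R σmax β) (x i))) l : ℝ) -
        padCenter (clipRadius d n R σmax β) (bucket d n σmin) μ l) * (sign (ω.1 l) : ℝ)| ≤
        G / bucket d n σmin)
    (hmed : ∀ j t, |√((rounds (2 * (2 ^ padExp d * univMax d n R σmin σmax β)) : ℝ) /
      (2 * (ρ / (4 * ((2 ^ padExp d : ℕ) : ℝ))))) * ω.2.1 j t| < (n : ℝ) / 2)
    (ht : trimCount (2 ^ padExp d) (2 * (2 ^ padExp d * univMax d n R σmin σmax β)) (3 / 4 * ρ)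
      (β / 4 / 3) ≤ n / 2)
    (hthr : ∀ t, |√((rounds (2 ^ padExp d * (2 * (2 ^ padExp d * univMax d n R σmin σmax β)) ^ 2)
      : ℝ) / (2 * (3 / 4 * ρ / 4))) * ω.2.2.1 t| <
        rankErr (2 ^ padExp d * (2 * (2 ^ padExp d * univMax d n R σmin σmax β)) ^ 2)
          (3 / 4 * ρ / 4) (β / 4 / 3)) :
    ‖gaussianMeanEst R σmin σmax ρ β x ω - μ‖ ≤
      (2 * trimCount (2 ^ padExp d) (2 * (2 ^ padExp d * univMax d n R σmin σmax β)) (3 / 4 * ρ)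
        (β / 4 / 3) + √(2 / (3 / 4 * (3 / 4 * ρ))) * ‖ω.2.2.2‖) * (2 * G) / n +
        √(d : ℝ) * bucket d n σmin + K := by
  set R' := clipRadius d n R σmax β with hR'
  set b := bucket d n σmin with hb_def
  have hn0 : (0 : ℝ) < n := by positivity
  have hb : 0 < b := by
    rw [hb_def, bucket_eq hd]
    have : 0 < √(n : ℝ) := Real.sqrt_pos.2 hn0
    positivity
  have hclip : ∀ i, clip R' (x i) = x i := fun i => clip_eq_self (hx i)
  have hU : ∀ i j, 0 ≤ pad (quantize R' b (x i)) j ∧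
      pad (quantize R' b (x i)) j ≤ univMax d n R σmin σmax β := by
    intro i j
    rw [pad, univMax, univSize_eq hd, ← hR', ← hb_def]
    split_ifs
    · exact quantize_mem hb (hx i) _
    · simp
  simp only [hclip] at hG
  have hshift := norm_shiftedClippedMean_sub_le (β := β / 4) hn hρ hU (padCenter R' b μ) hG hmed
    ht hthr
  rw [gaussianMeanEst]
  simp only [← hR', ← hb_def, hclip]
  set y := shiftedClippedMean (fun i => pad (quantize R' b (x i))) (univMax d n R σmin σmax β) ρ
    (β / 4) ω with hy
  set q := (1 / (n : ℝ)) • ∑ i, toEuc (pad (quantize R' b (x i))) with hq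
  set c := Fin.castLE (le_two_pow_padExp d) with hc
  set V₁ : EuclideanSpace ℝ (Fin d) := WithLp.toLp 2 fun j => b * (y - q) (c j) with hV₁
  set V₂ : EuclideanSpace ℝ (Fin d) := WithLp.toLp 2 fun j =>
    b * q (c j) - R' - ((1 / (n : ℝ)) • ∑ i, x i) j with hV₂
  have hdec : (WithLp.toLp 2 fun j => b * y (c j) - R' : EuclideanSpace ℝ (Fin d)) - μ =
      V₁ + V₂ + ((1 / (n : ℝ)) • ∑ i, x i - μ) := by
    ext j
    simp only [hV₁, hV₂, PiLp.add_apply, PiLp.sub_apply]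
    ring
  have h₁ : ‖V₁‖ ≤ b * ‖y - q‖ := by
    rw [← sq_le_sq₀ (norm_nonneg _) (by positivity), mul_pow, EuclideanSpace.real_norm_sq_eq,
      EuclideanSpace.real_norm_sq_eq]
    simp only [hV₁, mul_pow]
    rw [← Finset.mul_sum]
    gcongr
    rw [hc, sum_castLE_padExp fun l => ((y - q) l) ^ 2]
    exact Finset.sum_le_sum_of_subset_of_nonneg (Finset.subset_univ _) fun _ _ _ => sq_nonneg _
  have h₂ : ‖V₂‖ ≤ √(d : ℝ) * b := by
    refine norm_le_sqrt_mul_of_abs_le hb.le fun j => ?_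
    have e : V₂ j = (1 / (n : ℝ)) * ∑ i, (b * (quantize R' b (x i) j : ℝ) - R' - x i j) := by
      simp only [hV₂, hq, hc, PiLp.smul_apply, WithLp.ofLp_sum, Finset.sum_apply, toEuc,
        pad_castLE, smul_eq_mul, Finset.sum_sub_distrib, ← Finset.mul_sum, Finset.sum_const,
        Finset.card_univ, Fintype.card_fin, nsmul_eq_mul]
      field_simp
    rw [e, abs_mul, abs_of_pos (by positivity : 0 < 1 / (n : ℝ))]
    calc 1 / (n : ℝ) * |∑ i, (b * (quantize R' b (x i) j : ℝ) - R' - x i j)|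
        ≤ 1 / (n : ℝ) * ∑ _i : Fin n, b := by
          gcongr
          exact (Finset.abs_sum_le_sum_abs _ _).trans
            (Finset.sum_le_sum fun i _ => abs_quantize_sub_le hb (x i) j)
      _ = b := by simp [hn0.ne']
  rw [hdec]
  refine (norm_add₃_le).trans (add_le_add (add_le_add (h₁.trans ?_) h₂) hmean)
  calc b * ‖y - q‖ ≤ b * _ := mul_le_mul_of_nonneg_left hshift hb.le
    _ = _ := by field_simp

/-! ### The covariance matrix -/

theorem norm_sq_toEuclideanCLM_sqrt {d : ℕ} {S : Matrix (Fin d) (Fin d) ℝ} (hS : S.PosSemidef)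
    (v : EuclideanSpace ℝ (Fin d)) :
    ‖Matrix.toEuclideanCLM (𝕜 := ℝ) (CFC.sqrt S) v‖ ^ 2 = v ⬝ᵥ S *ᵥ v := by
  have hsa : IsSelfAdjoint (Matrix.toEuclideanCLM (𝕜 := ℝ) (CFC.sqrt S)) :=
    (CFC.sqrt_nonneg S).isSelfAdjoint.map _
  rw [← real_inner_self_eq_norm_sq, ← ContinuousLinearMap.adjoint_inner_right, hsa.adjoint_eq,
    ← mul_apply_eq_comp, ← map_mul, CFC.sqrt_mul_sqrt_self _ hS.nonneg,
    Matrix.inner_toEuclideanCLM]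

theorem posSemidef_of_sub_smul_one {d : ℕ} {S : Matrix (Fin d) (Fin d) ℝ} {σ : ℝ}
    (h : (S - σ ^ 2 • (1 : Matrix (Fin d) (Fin d) ℝ)).PosSemidef) : S.PosSemidef := by
  have := h.add ((Matrix.PosSemidef.one (n := Fin d) (R := ℝ)).smul (sq_nonneg σ))
  simpa using this

theorem dotProduct_self_eq_norm_sq {d : ℕ} (v : EuclideanSpace ℝ (Fin d)) :
    v ⬝ᵥ v = ‖v‖ ^ 2 := by
  rw [EuclideanSpace.real_norm_sq_eq, dotProduct]
  exact Finset.sum_congr rfl fun i _ => (sq _).symm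

/-- One unit vector suffices as a test, and it exists because `d ≥ 1`. -/
theorem le_sqrtNorm {d : ℕ} (hd : 1 ≤ d) {S : Matrix (Fin d) (Fin d) ℝ} {σ : ℝ} (hσ : 0 ≤ σ)
    (h : (S - σ ^ 2 • (1 : Matrix (Fin d) (Fin d) ℝ)).PosSemidef) : σ ≤ sqrtNorm S := by
  have hS := posSemidef_of_sub_smul_one h
  set v : EuclideanSpace ℝ (Fin d) := EuclideanSpace.single ⟨0, hd⟩ 1 with hv
  have hv1 : ‖v‖ = 1 := by simp [hv]
  have h1 := norm_sq_toEuclideanCLM_sqrt hS v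
  have h2 := h.dotProduct_mulVec_nonneg v
  simp only [star_trivial, Matrix.sub_mulVec, Matrix.smul_mulVec, Matrix.one_mulVec,
    dotProduct_sub, dotProduct_smul, dotProduct_self_eq_norm_sq, hv1, smul_eq_mul] at h2
  have h3 : σ ≤ ‖Matrix.toEuclideanCLM (𝕜 := ℝ) (CFC.sqrt S) v‖ :=
    (sq_le_sq₀ hσ (norm_nonneg _)).1 (by rw [h1]; linarith)
  exact h3.trans ((ContinuousLinearMap.le_opNorm _ _).trans_eq (by rw [hv1, mul_one, sqrtNorm]))

theorem sqrtNorm_le {d : ℕ} {S : Matrix (Fin d) (Fin d) ℝ} {σ : ℝ} (hσ : 0 ≤ σ)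
    (hS : S.PosSemidef) (h : (σ ^ 2 • (1 : Matrix (Fin d) (Fin d) ℝ) - S).PosSemidef) :
    sqrtNorm S ≤ σ := by
  refine ContinuousLinearMap.opNorm_le_bound _ hσ fun v => ?_
  have h1 := norm_sq_toEuclideanCLM_sqrt hS v
  have h2 := h.dotProduct_mulVec_nonneg v
  simp only [star_trivial, Matrix.sub_mulVec, Matrix.smul_mulVec, Matrix.one_mulVec,
    dotProduct_sub, dotProduct_smul, dotProduct_self_eq_norm_sq, smul_eq_mul] at h2
  rw [← sq_le_sq₀ (norm_nonneg _) (by positivity), h1, mul_pow]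
  linarith

/-! ### Estimates of the parameters -/

theorem rounds_mul_log_two_le (U : ℕ) : (rounds U : ℝ) * Real.log 2 ≤ Real.log (2 * (U + 1)) := by
  have h : 2 ^ rounds U ≤ 2 * (U + 1) := by
    rw [rounds]
    rcases Nat.eq_zero_or_pos U with rfl | hU
    · simp
    · have h1 := Nat.pow_pred_clog_lt_self one_lt_two (by omega : 1 < U + 1)
      have h2 : 0 < Nat.clog 2 (U + 1) := Nat.clog_pos one_lt_two (by omega)
      have h3 : Nat.clog 2 (U + 1) = (Nat.clog 2 (U + 1)).pred + 1 := by
        rw [Nat.pred_eq_sub_one]; omega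
      rw [h3, pow_succ]
      omega
  have h' : (2 : ℝ) ^ rounds U ≤ 2 * ((U : ℝ) + 1) := by exact_mod_cast h
  have := Real.log_le_log (by positivity) h'
  rwa [Real.log_pow] at this

theorem one_le_rounds {U : ℕ} (hU : 1 ≤ U) : 1 ≤ rounds U :=
  Nat.clog_pos one_lt_two (by omega)

theorem two_pow_padExp_le {d : ℕ} (hd : 1 ≤ d) : 2 ^ padExp d ≤ 2 * d := by
  rcases Nat.eq_or_lt_of_le hd with rfl | h
  · simp [padExp]
  · have h1 := Nat.pow_pred_clog_lt_self one_lt_two h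
    have h2 : 0 < Nat.clog 2 d := Nat.clog_pos one_lt_two h
    have h3 : Nat.clog 2 d = (Nat.clog 2 d).pred + 1 := by
      rw [Nat.pred_eq_sub_one]; omega
    rw [padExp, h3, pow_succ]
    omega

theorem log_two_bounds : 0.69 < Real.log 2 ∧ Real.log 2 < 0.7 :=
  ⟨by linarith [Real.log_two_gt_d9], by linarith [Real.log_two_lt_d9]⟩

theorem two_le_log_of_nine_le {X : ℝ} (hX : 9 ≤ X) : 2 ≤ Real.log X := by
  have h1 : Real.log 8 ≤ Real.log X := Real.log_le_log (by norm_num) (by linarith)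
  have h2 : Real.log 8 = 3 * Real.log 2 := by
    rw [show (8 : ℝ) = 2 ^ 3 by norm_num, Real.log_pow]; norm_num
  linarith [log_two_bounds.1]

theorem two_le_log_of_eight_le {y : ℝ} (hy : 8 ≤ y) : 2 ≤ Real.log y := by
  have h1 : Real.log 8 ≤ Real.log y := Real.log_le_log (by norm_num) hy
  have h2 : Real.log 8 = 3 * Real.log 2 := by
    rw [show (8 : ℝ) = 2 ^ 3 by norm_num, Real.log_pow]; norm_num
  linarith [log_two_bounds.1]

/-- Here `d + log (4n/β) ≥ 3`, so `u ≥ 4 √3 √2 > 9`. Then `log (du) ≥ 2`, which lets later estimates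
absorb additive constants. -/
theorem nine_le_univSize {d n : ℕ} {R σmin σmax β : ℝ} (hd : 1 ≤ d) (hn : 2 ≤ n) (hR : 0 ≤ R)
    (hσ : 0 < σmin) (hσ' : σmin ≤ σmax) (hβ : 0 < β) (hβ1 : β < 1) :
    9 ≤ univSize d n R σmin σmax β := by
  have hd' : (1 : ℝ) ≤ d := by exact_mod_cast hd
  have hn' : (2 : ℝ) ≤ n := by exact_mod_cast hn
  have h8 : (8 : ℝ) ≤ 4 * n / β := by rw [le_div_iff₀ hβ]; nlinarith
  have h3 : √3 ≤ √((d : ℝ) + Real.log (4 * (n : ℝ) / β)) :=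
    Real.sqrt_le_sqrt (by linarith [two_le_log_of_eight_le h8])
  have hr3 : (1.7 : ℝ) ≤ √3 := Real.le_sqrt_of_sq_le (by norm_num)
  have hr2 : (1.4 : ℝ) ≤ √(n : ℝ) := Real.le_sqrt_of_sq_le (by linarith)
  have hcr : 2 * σmin * 1.7 ≤ clipRadius d n R σmax β := by
    rw [clipRadius]
    have : 2 * σmin * 1.7 ≤ 2 * σmax * √((d : ℝ) + Real.log (4 * (n : ℝ) / β)) := by
      have := hr3.trans h3
      have : 0 ≤ σmax := hσ.le.trans hσ'
      gcongr
    linarith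
  rw [univSize, le_div_iff₀ hσ]
  have := mul_le_mul hcr hr2 (by norm_num) (by linarith)
  linarith

section Rounds

variable {d D U : ℕ} {u : ℝ}

theorem natCast_mul_le (hD : D ≤ 2 * d) (hU : (U : ℝ) ≤ u) :
    (D : ℝ) * U ≤ 2 * ((d : ℝ) * u) := by
  have hD' : (D : ℝ) ≤ 2 * d := by exact_mod_cast hD
  calc (D : ℝ) * U ≤ 2 * d * u := by gcongr
    _ = _ := by ring

theorem rounds_center_le (hD : D ≤ 2 * d) (hU : (U : ℝ) ≤ u) (hX : 9 ≤ (d : ℝ) * u) :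
    (rounds (2 * (D * U)) : ℝ) ≤ 5 * Real.log ((d : ℝ) * u) := by
  have h := rounds_mul_log_two_le (2 * (D * U))
  have hDU := natCast_mul_le hD hU
  set X := (d : ℝ) * u
  -- `8X + 2 ≤ X³` for `X ≥ 9`; the constant `5` then comes from `3 / log 2 < 5`.
  have h2 : Real.log (2 * (((2 * (D * U) : ℕ) : ℝ) + 1)) ≤ Real.log (X ^ 3) := by
    refine Real.log_le_log (by positivity) ?_
    push_cast
    nlinarith [mul_nonneg (by linarith : 0 ≤ X) (by nlinarith : 0 ≤ X ^ 2 - 81)]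
  rw [Real.log_pow] at h2
  push_cast at h2 h
  have hX2 := two_le_log_of_nine_le hX
  nlinarith [log_two_bounds.1, (Nat.cast_nonneg (rounds (2 * (D * U))) : (0 : ℝ) ≤ _)]

theorem rounds_threshold_le (hd : 1 ≤ d) (hD : D ≤ 2 * d) (hU : (U : ℝ) ≤ u)
    (hu : 9 ≤ u) :
    (rounds (D * (2 * (D * U)) ^ 2) : ℝ) ≤ 8 * Real.log ((d : ℝ) * u) := by
  have h := rounds_mul_log_two_le (D * (2 * (D * U)) ^ 2)
  have hDU := natCast_mul_le hD hU
  have hd' : (1 : ℝ) ≤ d := by exact_mod_cast hd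
  have hX : 9 ≤ (d : ℝ) * u := by nlinarith
  have hD' : (D : ℝ) ≤ 2 * ((d : ℝ) * u) := by
    have h1 : (D : ℝ) ≤ 2 * d := by exact_mod_cast hD
    nlinarith
  set X := (d : ℝ) * u
  have hV : ((D * (2 * (D * U)) ^ 2 : ℕ) : ℝ) ≤ 32 * X ^ 3 := by
    push_cast
    calc (D : ℝ) * (2 * (D * U)) ^ 2 ≤ (2 * X) * (2 * (2 * X)) ^ 2 := by gcongr
      _ = _ := by ring
  -- The constant `8` comes from `5 / log 2 < 8`.
  have h2 : Real.log (2 * (((D * (2 * (D * U)) ^ 2 : ℕ) : ℝ) + 1)) ≤ Real.log (X ^ 5) := by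
    refine Real.log_le_log (by positivity) ?_
    have h3 : 729 ≤ X ^ 3 := by
      have := pow_le_pow_left₀ (by norm_num) hX 3; norm_num at this; exact this
    have h4 : 81 ≤ X ^ 2 := by nlinarith
    calc _ ≤ 81 * X ^ 3 := by linarith
      _ ≤ X ^ 2 * X ^ 3 := by gcongr
      _ = X ^ 5 := by ring
  rw [Real.log_pow] at h2
  push_cast at h2 h
  have hX2 := two_le_log_of_nine_le hX
  nlinarith [log_two_bounds.1, (Nat.cast_nonneg (rounds (D * (2 * (D * U)) ^ 2)) : (0 : ℝ) ≤ _)]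

end Rounds

/-- Since `y² ≥ 64`, a constant factor inside the logarithm costs only a factor `3` outside. -/
theorem log_const_mul_le {a y z : ℝ} (hz : 0 < z) (hzy : z ≤ a * y) (ha : a ≤ 64) (hy : 8 ≤ y) :
    Real.log z ≤ 3 * Real.log y := by
  have : z ≤ y ^ 3 := by nlinarith [mul_nonneg (by linarith : 0 ≤ y) (by nlinarith : 0 ≤ y ^ 2 - 64)]
  calc Real.log z ≤ Real.log (y ^ 3) := Real.log_le_log hz this
    _ = _ := by rw [Real.log_pow]; norm_num

theorem eight_le_of_two_le {d X β : ℝ} (hd : 1 ≤ d) (hX : 2 ≤ X) (hβ : 0 < β) (hβ1 : β < 1) :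
    8 ≤ 4 * d * X / β := by
  rw [le_div_iff₀ hβ]; nlinarith

theorem median_failure_le {d D L : ℕ} {n τ ρ β X : ℝ} (hd : 1 ≤ d) (hDpos : 1 ≤ D)
    (hD : D ≤ 2 * d) (hLpos : 1 ≤ L)
    (hL : (L : ℝ) ≤ 5 * X) (hX : 2 ≤ X) (hρ : 0 < ρ) (hβ : 0 < β) (hβ1 : β < 1)
    (hτ : τ ^ 2 = X * Real.log (4 * d * X / β) / ρ) (hτ0 : 0 ≤ τ) (hn : 24 * (τ * √(d : ℝ)) ≤ n) :
    (D : ℝ) * (2 * L * Real.exp (-(n / 2) ^ 2 * (ρ / (4 * D)) / L)) ≤ β / 8 := by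
  have hd' : (1 : ℝ) ≤ d := by exact_mod_cast hd
  have hDpos' : (1 : ℝ) ≤ D := by exact_mod_cast hDpos
  have hD' : (D : ℝ) ≤ 2 * d := by exact_mod_cast hD
  have hLpos' : (1 : ℝ) ≤ L := by exact_mod_cast hLpos
  have hy := eight_le_of_two_le hd' hX hβ hβ1
  set y := 4 * (d : ℝ) * X / β with hydef
  have hly := two_le_log_of_eight_le hy
  have hlog : Real.log (16 * D * L / β) ≤ 3 * Real.log y := by
    refine log_const_mul_le (a := 40) (by positivity) ?_ (by norm_num) hy
    rw [hydef, mul_div_assoc', div_le_div_iff_of_pos_right hβ]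
    calc 16 * (D : ℝ) * L ≤ 16 * (2 * d) * (5 * X) := by gcongr
      _ = _ := by ring
  -- Source of `24`: the exponent requires `n² ρ ≥ 16 D L log (16DL/β)`, whose right side is at most
  -- `16 · 2 · 5 · 3 = 480` times `d X log y`, and `24² = 576`. The `√d` in the hypothesis on `n`
  -- pays for the parameter `ρ / (4D)` per coordinate.
  have hn2 : 576 * (d * (X * Real.log y)) ≤ n ^ 2 * ρ := by
    have h := pow_le_pow_left₀ (by positivity) hn 2
    rw [mul_pow, mul_pow, hτ, Real.sq_sqrt (by positivity)] at h
    calc 576 * (d * (X * Real.log y)) = 24 ^ 2 * (X * Real.log y / ρ * d) * ρ := by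
          field_simp; norm_num
      _ ≤ _ := by gcongr
  have hkey : Real.log (16 * D * L / β) ≤ (n / 2) ^ 2 * (ρ / (4 * D)) / L := by
    rw [le_div_iff₀ (by positivity), mul_div_assoc', le_div_iff₀ (by positivity)]
    have : Real.log (16 * D * L / β) * L * (4 * D) ≤ 3 * Real.log y * (5 * X) * (4 * (2 * d)) := by
      gcongr
    nlinarith [mul_nonneg (by linarith : (0:ℝ) ≤ d) (mul_nonneg (by linarith : 0 ≤ X) (by linarith : 0 ≤ Real.log y))]
  have hexp : Real.exp (-(n / 2) ^ 2 * (ρ / (4 * D)) / L) ≤ β / (16 * D * L) := by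
    rw [← Real.le_log_iff_exp_le (by positivity), ← inv_div (16 * (D : ℝ) * L), Real.log_inv, neg_mul, neg_div]
    exact neg_le_neg hkey
  calc (D : ℝ) * (2 * L * Real.exp (-(n / 2) ^ 2 * (ρ / (4 * D)) / L))
      ≤ D * (2 * L * (β / (16 * D * L))) := by gcongr
    _ = β / 8 := by field_simp; norm_num

/-- The first bound enters the final error; the second gives `t ≤ n/2` when `n ≥ 24 τ √d`. For the
latter, `2/√ρ ≤ τ` because both logarithms in `τ` are at least `2`. -/
theorem trimCount_le {d D u : ℕ} {τ ρ β X : ℝ} (hd : 1 ≤ d) (hD : D ≤ 2 * d)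
    (hLpos : 1 ≤ rounds (D * u ^ 2)) (hL : (rounds (D * u ^ 2) : ℝ) ≤ 8 * X) (hX : 2 ≤ X)
    (hρ : 0 < ρ) (hβ : 0 < β) (hβ1 : β < 1)
    (hτ : τ ^ 2 = X * Real.log (4 * d * X / β) / ρ) (hτ0 : 0 ≤ τ) :
    trimCount D u (3 / 4 * ρ) (β / 4 / 3) ≤ 3 * √(d : ℝ) / √ρ + 12 * τ ∧
      trimCount D u (3 / 4 * ρ) (β / 4 / 3) ≤ 12 * (τ * √(d : ℝ)) := by
  have hd' : (1 : ℝ) ≤ d := by exact_mod_cast hd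
  have hD' : (D : ℝ) ≤ 2 * d := by exact_mod_cast hD
  have hLpos' : (1 : ℝ) ≤ rounds (D * u ^ 2) := by exact_mod_cast hLpos
  have hy := eight_le_of_two_le hd' hX hβ hβ1
  set y := 4 * (d : ℝ) * X / β with hydef
  set L : ℝ := (rounds (D * u ^ 2) : ℝ) with hLdef
  have hly := two_le_log_of_eight_le hy
  have hlog : Real.log (2 * L / (β / 4 / 3)) ≤ 3 * Real.log y := by
    refine log_const_mul_le (a := 48) (by positivity) ?_ (by norm_num) hy
    rw [hydef, mul_div_assoc', div_div, div_div_eq_mul_div, div_le_div_iff_of_pos_right hβ]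
    nlinarith
  have h1 : rankErr (D * u ^ 2) (3 / 4 * ρ / 4) (β / 4 / 3) ≤ 12 * τ := by
    rw [rankErr, ← hLdef]
    refine Real.sqrt_le_iff.2 ⟨by positivity, ?_⟩
    rw [mul_pow, hτ, div_le_iff₀ (by positivity)]
    calc L * Real.log (2 * L / (β / 4 / 3)) ≤ L * (3 * Real.log y) := by gcongr
      _ ≤ 8 * X * (3 * Real.log y) := by gcongr
      _ ≤ 27 * (X * Real.log y) := by
        have : 0 ≤ X * Real.log y := by positivity
        linarith
      _ = _ := by field_simp; norm_num
  have h2 : √(2 * (D : ℝ) / (3 / 4 * ρ)) ≤ 3 * √(d : ℝ) / √ρ := by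
    refine Real.sqrt_le_iff.2 ⟨by positivity, ?_⟩
    rw [div_pow, mul_pow, Real.sq_sqrt (by positivity), Real.sq_sqrt hρ.le,
      div_le_div_iff₀ (by positivity) hρ]
    nlinarith [mul_le_mul_of_nonneg_right hD' hρ.le, mul_nonneg (by linarith : (0:ℝ) ≤ d) hρ.le]
  have hd1 : 1 ≤ √(d : ℝ) := Real.one_le_sqrt.2 hd'
  have h3 : 2 / √ρ ≤ τ := by
    rw [← sq_le_sq₀ (by positivity) hτ0, hτ, div_pow, Real.sq_sqrt hρ.le]
    gcongr
    nlinarith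
  have h4 : 3 * √(d : ℝ) / √ρ ≤ 12 * (τ * √(d : ℝ)) := by
    calc 3 * √(d : ℝ) / √ρ = 3 / 2 * (2 / √ρ * √(d : ℝ)) := by ring
      _ ≤ 3 / 2 * (τ * √(d : ℝ)) := by gcongr
      _ ≤ _ := by gcongr; norm_num
  rw [trimCount]
  constructor
  · have : 0 ≤ 3 * √(d : ℝ) / √ρ := by positivity
    exact max_le (by linarith) (by linarith)
  · exact max_le (h2.trans h4) (h1.trans (by nlinarith))

/-- Here `r = √l` with `l = log (nd/β)`. One factor `r` comes from the rotation and another from the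
norm of the added noise; their product is the full logarithm `l`, and a lone `r` is at most `2l`. -/
theorem error_product_le {A a τ r l P K W : ℝ} (hr : 0 ≤ r) (ha : 0 ≤ a) (hτ : 0 ≤ τ) (hl : 0 ≤ l)
    (hrl : r ^ 2 = l) (hrl' : r ≤ 2 * l) (hP : 0 ≤ P) (hA : A ≤ 6 * a + 24 * τ + 12 * a * r)
    (hK0 : 0 ≤ K) (hK : K ≤ 5 * P) (hW0 : 0 ≤ W) (hW : W ≤ 4 * r) :
    A * (2 * (K * W)) ≤ 2000 * (P * (a * l + τ * l)) := by
  calc A * (2 * (K * W)) ≤ (6 * a + 24 * τ + 12 * a * r) * (2 * (5 * P * (4 * r))) := by gcongr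
    _ = 40 * P * ((6 * a + 24 * τ) * r + 12 * a * r ^ 2) := by ring
    _ ≤ 40 * P * ((6 * a + 24 * τ) * (2 * l) + 12 * a * r ^ 2) := by gcongr
    _ = P * (960 * (a * l) + 1920 * (τ * l)) := by rw [hrl]; ring
    _ ≤ P * (2000 * (a * l) + 2000 * (τ * l)) := by
      have : 0 ≤ a * l := by positivity
      have : 0 ≤ τ * l := by positivity
      gcongr <;> norm_num
    _ = _ := by ring

set_option maxHeartbeats 1000000 in
theorem error_bound {d n D τ ρ β s σ t Z : ℝ} (hd : 1 ≤ d) (hn : 2 ≤ n) (hD1 : 1 ≤ D)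
    (hD : D ≤ 2 * d) (hτ : 0 ≤ τ) (hρ : 0 < ρ) (hβ : 0 < β) (hβ1 : β < 1) (hσ : 0 < σ)
    (hσs : σ ≤ s) (ht : t ≤ 3 * √d / √ρ + 12 * τ) (hZ0 : 0 ≤ Z)
    (hZ : Z ≤ 2 * √(D + Real.log (8 / β))) :
    (2 * t + √(2 / (3 / 4 * (3 / 4 * ρ))) * Z) *
        (2 * ((s * (2 * √(d + Real.log (4 * n / β))) + √d * (σ / √n)) *
          √(2 * Real.log (16 * n * D / β)))) / n + √d * (σ / √n) +
        s * (2 * √(d + Real.log (8 / β))) / √n ≤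
      2000 * (s * √(d + Real.log (n / β)) * (1 / √n + √d * Real.log (n * d / β) / (√ρ * n) +
        τ * Real.log (n * d / β) / n)) := by
  have hs : 0 < s := hσ.trans_le hσs
  obtain ⟨hl1, hl2⟩ := log_two_bounds
  have hnβ : 2 ≤ n / β := by rw [le_div_iff₀ hβ]; nlinarith
  have hndβ : 2 ≤ n * d / β := by rw [le_div_iff₀ hβ]; nlinarith
  have hlnβ : 0 ≤ Real.log (n / β) := Real.log_nonneg (by linarith)
  set Q := √(d + Real.log (n / β)) with hQ
  set l := Real.log (n * d / β) with hl
  have hl0 : 0.69 < l := hl1.trans_le (Real.log_le_log (by norm_num) hndβ)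
  set r := √l with hr
  have hrr : r ^ 2 = l := Real.sq_sqrt (by linarith)
  have hr1 : 0.8 ≤ r := Real.le_sqrt_of_sq_le (by linarith)
  have hQ1 : 1 ≤ Q := Real.one_le_sqrt.2 (by linarith)
  have hdQ : √d ≤ Q := Real.sqrt_le_sqrt (by linarith)
  have hsn : 1 ≤ √n := Real.one_le_sqrt.2 (by linarith)
  have hsd : 1 ≤ √d := Real.one_le_sqrt.2 hd
  have hlog4 : Real.log (4 * n / β) ≤ 1.4 + Real.log (n / β) := by
    rw [mul_div_assoc, Real.log_mul (by norm_num) (by positivity),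
      show (4 : ℝ) = 2 ^ 2 by norm_num, Real.log_pow]
    push_cast; linarith
  have hQ4 : √(d + Real.log (4 * n / β)) ≤ 2 * Q := by
    refine Real.sqrt_le_iff.2 ⟨by positivity, ?_⟩
    rw [mul_pow, Real.sq_sqrt (by positivity)]
    linarith
  have h84 : Real.log (8 / β) ≤ Real.log (4 * n / β) :=
    Real.log_le_log (by positivity) (by gcongr; linarith)
  have hQ8 : √(d + Real.log (8 / β)) ≤ 2 * Q := (Real.sqrt_le_sqrt (by linarith)).trans hQ4
  -- The bucket size `σ_min / √n` keeps the rounding bias within the order of the sampling error.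
  have hbd : √d * (σ / √n) ≤ s * Q * (1 / √n) := by
    calc √d * (σ / √n) = σ * √d * (1 / √n) := by ring
      _ ≤ _ := by gcongr
  have hbd' : √d * (σ / √n) ≤ s * Q := hbd.trans (by
    have : 1 / √n ≤ 1 := by rw [div_le_one (by positivity)]; exact hsn
    exact mul_le_of_le_one_right (by positivity) this)
  have hlogndβ : 0 < n * d / β := by positivity
  have hΛ : Real.log (16 * n * D / β) ≤ 7 * l := by
    have h1 : Real.log (16 * n * D / β) ≤ Real.log (32 * (n * d / β)) := by
      refine Real.log_le_log (by positivity) ?_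
      rw [mul_div_assoc', div_le_div_iff_of_pos_right hβ]
      nlinarith
    rw [Real.log_mul (by norm_num) (by positivity), show (32 : ℝ) = 2 ^ 5 by norm_num,
      Real.log_pow] at h1
    push_cast at h1
    linarith
  have hΛ' : √(2 * Real.log (16 * n * D / β)) ≤ 4 * r := by
    refine Real.sqrt_le_iff.2 ⟨by positivity, ?_⟩
    rw [mul_pow, hrr]; linarith
  have h8l : Real.log (8 / β) ≤ 4 * l := by
    have h1 : Real.log (8 / β) ≤ Real.log (4 * (n * d / β)) := by
      refine Real.log_le_log (by positivity) ?_
      rw [mul_div_assoc', div_le_div_iff_of_pos_right hβ]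
      nlinarith
    rw [Real.log_mul (by norm_num) (by positivity), show (4 : ℝ) = 2 ^ 2 by norm_num,
      Real.log_pow] at h1
    push_cast at h1
    linarith
  have hZ' : Z ≤ 6 * (√d * r) := by
    have : √(D + Real.log (8 / β)) ≤ 3 * (√d * r) := by
      refine Real.sqrt_le_iff.2 ⟨by positivity, ?_⟩
      rw [mul_pow, mul_pow, Real.sq_sqrt (by linarith), hrr]
      nlinarith
    linarith
  have hρ' : √(2 / (3 / 4 * (3 / 4 * ρ))) ≤ 2 / √ρ := by
    refine Real.sqrt_le_iff.2 ⟨by positivity, ?_⟩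
    rw [div_pow, Real.sq_sqrt hρ.le, div_le_div_iff₀ (by positivity) hρ]
    nlinarith
  have hfirst : 2 * t + √(2 / (3 / 4 * (3 / 4 * ρ))) * Z ≤
      6 * (√d / √ρ) + 24 * τ + 12 * (√d / √ρ) * r := by
    have : √(2 / (3 / 4 * (3 / 4 * ρ))) * Z ≤ 2 / √ρ * (6 * (√d * r)) := by gcongr
    have e : 2 / √ρ * (6 * (√d * r)) = 12 * (√d / √ρ) * r := by ring
    have e' : 3 * √d / √ρ = 3 * (√d / √ρ) := by ring
    linarith
  set a := √d / √ρ with ha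
  have ha0 : 0 ≤ a := by positivity
  have hK : s * (2 * √(d + Real.log (4 * n / β))) + √d * (σ / √n) ≤ 5 * (s * Q) := by
    have : s * (2 * √(d + Real.log (4 * n / β))) ≤ s * (2 * (2 * Q)) := by gcongr
    linarith
  have hr2 : r ≤ 2 * l := by rw [← hrr]; nlinarith
  have hmain : (2 * t + √(2 / (3 / 4 * (3 / 4 * ρ))) * Z) *
        (2 * ((s * (2 * √(d + Real.log (4 * n / β))) + √d * (σ / √n)) *
          √(2 * Real.log (16 * n * D / β)))) ≤ 2000 * (s * Q * (a * l + τ * l)) := by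
    have hK0 : 0 ≤ s * (2 * √(d + Real.log (4 * n / β))) + √d * (σ / √n) := by positivity
    exact error_product_le (by linarith) ha0 hτ (by linarith) hrr hr2 (by positivity) hfirst hK0 hK
      (Real.sqrt_nonneg _) hΛ'
  have hthird : s * (2 * √(d + Real.log (8 / β))) / √n ≤ 4 * (s * Q * (1 / √n)) := by
    calc _ ≤ s * (2 * (2 * Q)) / √n := by gcongr
      _ = _ := by ring
  have hn1 : 0 ≤ s * Q * (1 / √n) := by positivity
  refine (add_le_add (add_le_add (div_le_div_of_nonneg_right hmain (by linarith : 0 ≤ n)) hbd)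
    hthird).trans ?_
  calc 2000 * (s * Q * (a * l + τ * l)) / n + s * Q * (1 / √n) + 4 * (s * Q * (1 / √n))
      ≤ 2000 * (s * Q * (a * l + τ * l)) / n + 2000 * (s * Q * (1 / √n)) := by linarith
    _ = _ := by rw [ha]; field_simp; ring

/-! ### Probabilities of the failure events -/

theorem measure_iUnion_le_card_mul {ι Ω : Type*} [Fintype ι] [MeasurableSpace Ω] (P : Measure Ω)
    {A : ι → Set Ω} {ε : ℝ} (h : ∀ i, P (A i) ≤ ENNReal.ofReal ε) :
    P (⋃ i, A i) ≤ ENNReal.ofReal (Fintype.card ι * ε) := by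
  refine (measure_iUnion_fintype_le _ _).trans ((Finset.sum_le_sum fun i _ => h i).trans ?_)
  rw [Finset.sum_const, Finset.card_univ, nsmul_eq_mul, ENNReal.ofReal_mul (by positivity)]
  simp

theorem norm_toEuclideanCLM_sqrt_le {d : ℕ} (S : Matrix (Fin d) (Fin d) ℝ)
    (z : EuclideanSpace ℝ (Fin d)) :
    ‖Matrix.toEuclideanCLM (𝕜 := ℝ) (CFC.sqrt S) z‖ ≤ sqrtNorm S * ‖z‖ :=
  ContinuousLinearMap.le_opNorm _ _

theorem sqrtNorm_nonneg {d : ℕ} (S : Matrix (Fin d) (Fin d) ℝ) : 0 ≤ sqrtNorm S := norm_nonneg _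

theorem multivariateGaussian_norm_tail {d : ℕ} (μ : EuclideanSpace ℝ (Fin d))
    (S : Matrix (Fin d) (Fin d) ℝ) {t : ℝ} (ht : 0 ≤ t) :
    multivariateGaussian μ S {x | sqrtNorm S * (2 * √((d : ℝ) + t)) < ‖x - μ‖} ≤
      ENNReal.ofReal (Real.exp (-t)) := by
  rw [multivariateGaussian, Measure.map_apply (by fun_prop)
    (measurableSet_lt measurable_const (by fun_prop))]
  refine (measure_mono fun z hz => ?_).trans (stdGaussian_norm_tail d ht)
  simp only [Set.mem_preimage, Set.mem_ofPred_eq, add_sub_cancel_left] at hz ⊢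
  exact lt_of_mul_lt_mul_left (hz.trans_le (norm_toEuclideanCLM_sqrt_le S z)) (sqrtNorm_nonneg S)

theorem pi_multivariateGaussian_norm_tail {n d : ℕ} (μ : EuclideanSpace ℝ (Fin d))
    (S : Matrix (Fin d) (Fin d) ℝ) {t : ℝ} (ht : 0 ≤ t) :
    (Measure.pi fun _ : Fin n => multivariateGaussian μ S)
      {x | ∃ i, sqrtNorm S * (2 * √((d : ℝ) + t)) < ‖x i - μ‖} ≤
      ENNReal.ofReal (n * Real.exp (-t)) := by
  simpa using pi_exists_le (ι := Fin n) _ (multivariateGaussian_norm_tail μ S ht)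

/-- The centred mean is `n^{-1/2} Σ^{1/2}` applied to the normalized sum of standard Gaussians,
itself standard Gaussian. -/
theorem sampleMean_tail {n d : ℕ} (hn : 0 < n) (μ : EuclideanSpace ℝ (Fin d))
    (S : Matrix (Fin d) (Fin d) ℝ) {t : ℝ} (ht : 0 ≤ t) :
    (Measure.pi fun _ : Fin n => multivariateGaussian μ S)
      {x | sqrtNorm S * (2 * √((d : ℝ) + t)) / √(n : ℝ) < ‖(1 / (n : ℝ)) • ∑ i, x i - μ‖} ≤
      ENNReal.ofReal (Real.exp (-t)) := by
  have hn' : (0 : ℝ) < n := by exact_mod_cast hn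
  have hsn : 0 < √(n : ℝ) := Real.sqrt_pos.2 hn'
  have hpi : (Measure.pi fun _ : Fin n => multivariateGaussian μ S) =
      (Measure.pi fun _ : Fin n => stdGaussian (EuclideanSpace ℝ (Fin d))).map
        fun z i => μ + Matrix.toEuclideanCLM (𝕜 := ℝ) (CFC.sqrt S) (z i) :=
    (Measure.pi_map_pi fun _ => by fun_prop).symm
  rw [hpi, Measure.map_apply (by fun_prop) (measurableSet_lt measurable_const (by fun_prop))]
  have htail := stdGaussian_norm_tail d ht
  rw [← map_sum_pi_stdGaussian hn, Measure.map_apply (by fun_prop)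
    (measurableSet_lt measurable_const measurable_norm)] at htail
  refine (measure_mono fun z hz => ?_).trans htail
  simp only [Set.mem_preimage, Set.mem_ofPred_eq] at hz ⊢
  have e : (1 / (n : ℝ)) • ∑ i, (μ + Matrix.toEuclideanCLM (𝕜 := ℝ) (CFC.sqrt S) (z i)) - μ =
      (√(n : ℝ))⁻¹ • Matrix.toEuclideanCLM (𝕜 := ℝ) (CFC.sqrt S) ((√(n : ℝ))⁻¹ • ∑ i, z i) := by
    rw [Finset.sum_add_distrib, Finset.sum_const, Finset.card_univ, Fintype.card_fin, smul_add,
      ← Nat.cast_smul_eq_nsmul ℝ, smul_smul, one_div, inv_mul_cancel₀ hn'.ne', one_smul,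
      add_sub_cancel_left, map_smul, map_sum, smul_smul, ← mul_inv, Real.mul_self_sqrt hn'.le]
  rw [e, norm_smul, norm_inv, Real.norm_of_nonneg hsn.le, div_lt_iff₀ hsn, inv_mul_eq_div,
    div_mul_cancel₀ _ hsn.ne'] at hz
  exact lt_of_mul_lt_mul_left (hz.trans_le (norm_toEuclideanCLM_sqrt_le S _)) (sqrtNorm_nonneg S)

theorem privQuant_noise_tail {U : ℕ} {ρ e : ℝ} (hρ : 0 < ρ) (he : 0 ≤ e) :
    (Measure.pi fun _ : Fin (rounds U) => gaussianReal 0 1)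
      {z | ∃ t, e ≤ |√((rounds U : ℝ) / (2 * ρ)) * z t|} ≤
      ENNReal.ofReal (2 * rounds U * Real.exp (-e ^ 2 * ρ / rounds U)) := by
  have h := pi_exists_le (ι := Fin (rounds U)) _
    (gaussianReal_abs_tail (s := √((rounds U : ℝ) / (2 * ρ))) he)
  refine h.trans (le_of_eq ?_)
  rw [Real.sq_sqrt (by positivity), Fintype.card_fin]
  congr 1
  rw [show -e ^ 2 / (2 * ((rounds U : ℝ) / (2 * ρ))) = -e ^ 2 * ρ / rounds U by field_simp]
  ring

theorem threshold_noise_tail {U : ℕ} {ρ β : ℝ} (hU : 1 ≤ U) (hρ : 0 < ρ) (hβ : 0 < β)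
    (hβ1 : β ≤ 1) :
    (Measure.pi fun _ : Fin (rounds U) => gaussianReal 0 1)
      {z | ∃ t, rankErr U ρ β ≤ |√((rounds U : ℝ) / (2 * ρ)) * z t|} ≤ ENNReal.ofReal β := by
  have hL : (1 : ℝ) ≤ rounds U := by exact_mod_cast one_le_rounds hU
  have hlog : 0 ≤ Real.log (2 * (rounds U : ℝ) / β) :=
    Real.log_nonneg (by rw [le_div_iff₀ hβ]; linarith)
  refine (privQuant_noise_tail hρ (Real.sqrt_nonneg _)).trans
    (ENNReal.ofReal_le_ofReal (le_of_eq ?_))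
  rw [Real.sq_sqrt (by positivity), show -((rounds U : ℝ) * Real.log (2 * (rounds U : ℝ) / β) / ρ) * ρ / rounds U =
    -Real.log (2 * (rounds U : ℝ) / β) by field_simp, Real.exp_neg, Real.exp_log (by positivity)]
  field_simp

theorem center_noise_tail {D U : ℕ} {ρ e : ℝ} (hρ : 0 < ρ) (he : 0 ≤ e) :
    (Measure.pi fun _ : Fin D => Measure.pi fun _ : Fin (rounds U) => gaussianReal 0 1)
      {z | ∃ j t, e ≤ |√((rounds U : ℝ) / (2 * ρ)) * z j t|} ≤
      ENNReal.ofReal (D * (2 * rounds U * Real.exp (-e ^ 2 * ρ / rounds U))) := by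
  simpa using pi_exists_le (ι := Fin D) _ (privQuant_noise_tail (U := U) hρ he)

/-- Hadamard entries are `±1`, so every row leaves the sum of squares of the weights unchanged; the
union runs over the `n · 2 ^ k` pairs of point and row. -/
theorem rotation_tail {n k : ℕ} (x : Fin n → Fin (2 ^ k) → ℝ) {t : ℝ} (ht : 0 ≤ t) :
    (Measure.pi fun _ : Fin (2 ^ k) => (PMF.uniformOfFintype Bool).toMeasure)
      {s | ∃ i j, √(∑ l, x i l ^ 2) * √(2 * t) <
        |∑ l, (hadamard k j l : ℝ) * x i l * (sign (s l) : ℝ)|} ≤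
      ENNReal.ofReal (n * 2 ^ k * (2 * Real.exp (-t))) := by
  have hone : ∀ p : Fin n × Fin (2 ^ k),
      (Measure.pi fun _ : Fin (2 ^ k) => (PMF.uniformOfFintype Bool).toMeasure)
      {s | √(∑ l, x p.1 l ^ 2) * √(2 * t) <
        |∑ l, (hadamard k p.2 l : ℝ) * x p.1 l * (sign (s l) : ℝ)|} ≤
      ENNReal.ofReal (2 * Real.exp (-t)) := by
    rintro ⟨i, j⟩
    have h := rademacher_tail (fun l => (hadamard k j l : ℝ) * x i l) ht
    have e : ∀ l, ((hadamard k j l : ℝ) * x i l) ^ 2 = x i l ^ 2 := fun l => by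
      rw [mul_pow, ← Int.cast_pow, hadamard_sq]; simp
    simpa only [e] using h
  refine (measure_mono ?_).trans ((measure_iUnion_le_card_mul _ hone).trans_eq ?_)
  · rintro s ⟨i, j, h⟩
    exact Set.mem_iUnion.2 ⟨(i, j), h⟩
  · simp

/-- Conditioning on the data: the signs are independent of it, so the rotation bound may use a
threshold that depends on the data. -/
theorem prod_le_of_forall_section_le {X Y : Type*} [MeasurableSpace X] [MeasurableSpace Y]
    (P : Measure X) [IsProbabilityMeasure P] (Q : Measure Y) [SFinite Q] {A : Set (X × Y)}
    (hA : MeasurableSet A) {ε : ENNReal} (h : ∀ x, Q (Prod.mk x ⁻¹' A) ≤ ε) :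
    (P.prod Q) A ≤ ε := by
  rw [Measure.prod_apply hA]
  exact (lintegral_mono h).trans (by simp)

theorem measurable_quantize_clip {d : ℕ} (R' b : ℝ) :
    Measurable fun x : EuclideanSpace ℝ (Fin d) => quantize R' b (clip R' x) := by
  unfold quantize clip
  fun_prop

theorem data_rotation_tail {n d : ℕ} (P : Measure (Fin n → EuclideanSpace ℝ (Fin d)))
    [IsProbabilityMeasure P] (R' b : ℝ) (w : Fin (2 ^ padExp d) → ℝ) {t : ℝ} (ht : 0 ≤ t) :
    (P.prod (Measure.pi fun _ : Fin (2 ^ padExp d) => (PMF.uniformOfFintype Bool).toMeasure))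
      {p | ∃ i j, √(∑ l, ((pad (quantize R' b (clip R' (p.1 i))) l : ℝ) - w l) ^ 2) * √(2 * t) <
        |∑ l, (hadamard (padExp d) j l : ℝ) *
          ((pad (quantize R' b (clip R' (p.1 i))) l : ℝ) - w l) * (sign (p.2 l) : ℝ)|} ≤
      ENNReal.ofReal (n * 2 ^ padExp d * (2 * Real.exp (-t))) := by
  refine prod_le_of_forall_section_le P _ ?_ fun x => ?_
  -- The event depends on the samples only through integer vectors, a discrete space where every set
  -- is measurable.
  · have hm : Measurable fun p : (Fin n → EuclideanSpace ℝ (Fin d)) × (Fin (2 ^ padExp d) → Bool) =>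
        ((fun i => quantize R' b (clip R' (p.1 i)) : Fin n → Fin d → ℤ), p.2) := by
      refine Measurable.prodMk (measurable_pi_lambda _ fun i => ?_) measurable_snd
      exact (measurable_quantize_clip R' b).comp ((measurable_pi_apply i).comp measurable_fst)
    exact hm (MeasurableSet.of_discrete (s := {p : (Fin n → Fin d → ℤ) ×
      (Fin (2 ^ padExp d) → Bool) | ∃ i j, √(∑ l, ((pad (p.1 i) l : ℝ) - w l) ^ 2) * √(2 * t) <
        |∑ l, (hadamard (padExp d) j l : ℝ) *
          ((pad (p.1 i) l : ℝ) - w l) * (sign (p.2 l) : ℝ)|}))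
  · exact rotation_tail (fun i l => (pad (quantize R' b (clip R' (x i))) l : ℝ) - w l) ht

instance isProbabilityMeasure_noiseLaw (D U : ℕ) : IsProbabilityMeasure (noiseLaw D U) := by
  unfold noiseLaw; infer_instance

/-- Each bad event is a preimage under a measure-preserving projection; only `B₅` couples the data
with the signs. The bound holds for outer measure, so none of the sets needs to be measurable. -/
theorem prod_noiseLaw_union_le {X : Type*} [MeasurableSpace X] {D U : ℕ} (P : Measure X)
    [IsProbabilityMeasure P] {B₁ B₂ : Set X} {B₃ : Set (Fin D → Fin (rounds (2 * (D * U))) → ℝ)}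
    {B₄ : Set (Fin (rounds (D * (2 * (D * U)) ^ 2)) → ℝ)} {B₅ : Set (X × (Fin D → Bool))}
    {B₆ : Set (EuclideanSpace ℝ (Fin D))} {A : Set (X × Noise D U)}
    (hA : ∀ p ∈ A, p.1 ∈ B₁ ∨ p.1 ∈ B₂ ∨ p.2.2.1 ∈ B₃ ∨ p.2.2.2.1 ∈ B₄ ∨ (p.1, p.2.1) ∈ B₅ ∨
      p.2.2.2.2 ∈ B₆) :
    (P.prod (noiseLaw D U)) A ≤ P B₁ + (P B₂ +
      ((Measure.pi fun _ => Measure.pi fun _ => gaussianReal 0 1) B₃ +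
      ((Measure.pi fun _ => gaussianReal 0 1) B₄ +
      ((P.prod (Measure.pi fun _ => (PMF.uniformOfFintype Bool).toMeasure)) B₅ +
      stdGaussian (EuclideanSpace ℝ (Fin D)) B₆)))) := by
  have hX : MeasurePreserving (fun p : X × Noise D U => p.1) (P.prod (noiseLaw D U)) P :=
    measurePreserving_fst
  have hN : MeasurePreserving (fun p : X × Noise D U => p.2) (P.prod (noiseLaw D U))
      (noiseLaw D U) := measurePreserving_snd
  have hN2 : MeasurePreserving (fun ω : Noise D U => ω.2) (noiseLaw D U) _ := measurePreserving_snd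
  have hm3 := (measurePreserving_fst.comp hN2).comp hN
  have hN3 := (measurePreserving_snd.comp hN2).comp hN
  have hm4 := measurePreserving_fst.comp hN3
  have hm6 := measurePreserving_snd.comp hN3
  have hm5 : MeasurePreserving (Prod.map id fun ω : Noise D U => ω.1) (P.prod (noiseLaw D U))
      (P.prod (Measure.pi fun _ => (PMF.uniformOfFintype Bool).toMeasure)) :=
    (MeasurePreserving.id P).prod measurePreserving_fst
  refine (measure_mono (t := _ ∪ (_ ∪ (_ ∪ (_ ∪ (_ ∪ _))))) fun p hp => hA p hp).trans ?_
  refine (measure_union_le _ _).trans (add_le_add (hX.measure_preimage_le B₁) ?_)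
  refine (measure_union_le _ _).trans (add_le_add (hX.measure_preimage_le B₂) ?_)
  refine (measure_union_le _ _).trans (add_le_add (hm3.measure_preimage_le B₃) ?_)
  refine (measure_union_le _ _).trans (add_le_add (hm4.measure_preimage_le B₄) ?_)
  exact (measure_union_le _ _).trans (add_le_add (hm5.measure_preimage_le B₅)
    (hm6.measure_preimage_le B₆))

theorem tau_sq {d n : ℕ} {R σmin σmax ρ β : ℝ} (hρ : 0 < ρ)
    (h1 : 0 ≤ Real.log ((d : ℝ) * univSize d n R σmin σmax β))
    (h2 : 0 ≤ Real.log (4 * (d : ℝ) * Real.log ((d : ℝ) * univSize d n R σmin σmax β) / β)) :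
    tau d n R σmin σmax ρ β ^ 2 = Real.log ((d : ℝ) * univSize d n R σmin σmax β) *
      Real.log (4 * (d : ℝ) * Real.log ((d : ℝ) * univSize d n R σmin σmax β) / β) / ρ :=
  Real.sq_sqrt (by positivity)

theorem gaussianMeanEst_failure_le {d n : ℕ} {R σmin σmax ρ β : ℝ} {μ : EuclideanSpace ℝ (Fin d)}
    {S : Matrix (Fin d) (Fin d) ℝ} (hd : 1 ≤ d) (hn : 2 ≤ n) (hσ : 0 < σmin) (hσσ : σmin ≤ σmax)
    (hρ : 0 < ρ) (hβ : 0 < β) (hβ1 : β < 1) (hμ : ‖μ‖ ≤ R)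
    (hS1 : (S - σmin ^ 2 • (1 : Matrix (Fin d) (Fin d) ℝ)).PosSemidef)
    (hS2 : (σmax ^ 2 • (1 : Matrix (Fin d) (Fin d) ℝ) - S).PosSemidef)
    (hnτ : 24 * (tau d n R σmin σmax ρ β * √(d : ℝ)) ≤ (n : ℝ)) :
    ((Measure.pi fun _ : Fin n => multivariateGaussian μ S).prod
        (noiseLaw (2 ^ padExp d) (univMax d n R σmin σmax β)))
      {p | ¬ ‖gaussianMeanEst R σmin σmax ρ β p.1 p.2 - μ‖ ≤
        2000 * (sqrtNorm S * √((d : ℝ) + Real.log ((n : ℝ) / β)) *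
          (1 / √(n : ℝ) +
            √(d : ℝ) * Real.log ((n : ℝ) * (d : ℝ) / β) / (√ρ * (n : ℝ)) +
            tau d n R σmin σmax ρ β * Real.log ((n : ℝ) * (d : ℝ) / β) / (n : ℝ)))}
      ≤ ENNReal.ofReal β := by
  have hd' : (1 : ℝ) ≤ d := by exact_mod_cast hd
  have hn' : (2 : ℝ) ≤ n := by exact_mod_cast hn
  have hR : 0 ≤ R := (norm_nonneg _).trans hμ
  have hu : 9 ≤ univSize d n R σmin σmax β := nine_le_univSize hd hn hR hσ hσσ hβ hβ1
  have hX9 : 9 ≤ (d : ℝ) * univSize d n R σmin σmax β := by nlinarith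
  have hX := two_le_log_of_nine_le hX9
  have hy := two_le_log_of_eight_le (eight_le_of_two_le hd' hX hβ hβ1)
  have hτ2 := tau_sq (d := d) (n := n) (R := R) (σmin := σmin) (σmax := σmax) hρ
    (zero_le_two.trans hX) (zero_le_two.trans hy)
  have hτ0 : 0 ≤ tau d n R σmin σmax ρ β := Real.sqrt_nonneg _
  have hU : (univMax d n R σmin σmax β : ℝ) ≤ univSize d n R σmin σmax β :=
    Nat.floor_le (by linarith)
  have hU1 : 1 ≤ univMax d n R σmin σmax β := Nat.le_floor (by push_cast; linarith)
  have hD1 : 1 ≤ 2 ^ padExp d := Nat.one_le_two_pow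
  have hD := two_pow_padExp_le hd
  have hL₁ := rounds_center_le hD hU hX9
  have hL₂ := rounds_threshold_le hd hD hU hu
  have hs := le_sqrtNorm hd hσ.le hS1
  have hs' := sqrtNorm_le (hσ.le.trans hσσ) (posSemidef_of_sub_smul_one hS1) hS2
  have hs0 : 0 < sqrtNorm S := hσ.trans_le hs
  set τ := tau d n R σmin σmax ρ β with hτdef
  set U := univMax d n R σmin σmax β with hUdef
  set D := 2 ^ padExp d with hDdef
  set X := Real.log ((d : ℝ) * univSize d n R σmin σmax β) with hXdef
  set s := sqrtNorm S with hsdef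
  set R' := clipRadius d n R σmax β with hR'def
  set b := bucket d n σmin with hbdef
  have hb : 0 < b := by
    rw [hbdef, bucket_eq hd]
    have : 0 < √(n : ℝ) := Real.sqrt_pos.2 (by linarith)
    positivity
  have hDU : 1 ≤ D * U := Nat.one_le_iff_ne_zero.2 (by positivity)
  have hV : 1 ≤ D * (2 * (D * U)) ^ 2 := Nat.one_le_iff_ne_zero.2 (by positivity)
  obtain ⟨ht1, ht2⟩ := trimCount_le hd hD (one_le_rounds hV) hL₂ hX hρ hβ hβ1 hτ2 hτ0
  have hmed := median_failure_le hd hD1 hD (one_le_rounds (by omega : 1 ≤ 2 * (D * U))) hL₁ hX hρ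
    hβ hβ1 hτ2 hτ0 hnτ
  have hD1' : (1 : ℝ) ≤ D := by exact_mod_cast hD1
  have hD' : (D : ℝ) ≤ 2 * d := by exact_mod_cast hD
  have hlog4n : 0 ≤ Real.log (4 * n / β) :=
    Real.log_nonneg (by rw [le_div_iff₀ hβ]; nlinarith)
  have hlog8 : 0 ≤ Real.log (8 / β) := Real.log_nonneg (by rw [le_div_iff₀ hβ]; nlinarith)
  have hlog16 : 0 ≤ Real.log (16 * n * D / β) :=
    Real.log_nonneg (by rw [le_div_iff₀ hβ]; nlinarith)
  have hbad := prod_noiseLaw_union_le (D := D) (U := U)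
    (Measure.pi fun _ : Fin n => multivariateGaussian μ S)
    (B₁ := {x | ∃ i, s * (2 * √((d : ℝ) + Real.log (4 * n / β))) < ‖x i - μ‖})
    (B₂ := {x | s * (2 * √((d : ℝ) + Real.log (8 / β))) / √(n : ℝ) <
      ‖(1 / (n : ℝ)) • ∑ i, x i - μ‖})
    (B₃ := {z | ∃ j t, (n : ℝ) / 2 ≤
      |√((rounds (2 * (D * U)) : ℝ) / (2 * (ρ / (4 * (D : ℝ))))) * z j t|})
    (B₄ := {z | ∃ t, rankErr (D * (2 * (D * U)) ^ 2) (3 / 4 * ρ / 4) (β / 4 / 3) ≤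
      |√((rounds (D * (2 * (D * U)) ^ 2) : ℝ) / (2 * (3 / 4 * ρ / 4))) * z t|})
    (B₅ := {p | ∃ i j, √(∑ l, ((pad (quantize R' b (clip R' (p.1 i))) l : ℝ) -
        padCenter R' b μ l) ^ 2) * √(2 * Real.log (16 * n * D / β)) <
      |∑ l, (hadamard (padExp d) j l : ℝ) *
        ((pad (quantize R' b (clip R' (p.1 i))) l : ℝ) - padCenter R' b μ l) *
          (sign (p.2 l) : ℝ)|})
    (B₆ := {z | 2 * √((D : ℝ) + Real.log (8 / β)) < ‖z‖})
    (A := {p | ¬ ‖gaussianMeanEst R σmin σmax ρ β p.1 p.2 - μ‖ ≤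
        2000 * (s * √((d : ℝ) + Real.log ((n : ℝ) / β)) *
          (1 / √(n : ℝ) +
            √(d : ℝ) * Real.log ((n : ℝ) * (d : ℝ) / β) / (√ρ * (n : ℝ)) +
            τ * Real.log ((n : ℝ) * (d : ℝ) / β) / (n : ℝ)))}) ?_
  · refine hbad.trans ?_
    have e8 : Real.exp (-Real.log (8 / β)) = β / 8 := by
      rw [Real.exp_neg, Real.exp_log (by positivity), inv_div]
    have p₁ := pi_multivariateGaussian_norm_tail (n := n) μ S hlog4n
    have p₂ := sampleMean_tail (by omega : 0 < n) μ S hlog8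
    have p₃ := center_noise_tail (D := D) (U := 2 * (D * U)) (ρ := ρ / (4 * D)) (e := (n : ℝ) / 2)
      (by positivity) (by positivity)
    have p₄ := threshold_noise_tail hV (ρ := 3 / 4 * ρ / 4) (β := β / 4 / 3) (by positivity)
      (by positivity) (by linarith)
    have p₅ := data_rotation_tail (Measure.pi fun _ : Fin n => multivariateGaussian μ S) R' b
      (padCenter R' b μ) hlog16
    have p₆ := stdGaussian_norm_tail D hlog8
    have q₁ : (n : ℝ) * Real.exp (-Real.log (4 * n / β)) = β / 4 := by
      rw [Real.exp_neg, Real.exp_log (by positivity)]; field_simp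
    have q₅ : (n : ℝ) * 2 ^ padExp d * (2 * Real.exp (-Real.log (16 * n * D / β))) = β / 8 := by
      have : (2 : ℝ) ^ padExp d = D := by rw [hDdef]; push_cast; rfl
      rw [this, Real.exp_neg, Real.exp_log (by positivity)]
      field_simp; norm_num
    rw [q₁] at p₁
    rw [e8] at p₂ p₆
    rw [q₅] at p₅
    refine (add_le_add p₁ (add_le_add p₂ (add_le_add (p₃.trans (ENNReal.ofReal_le_ofReal hmed))
      (add_le_add p₄ (add_le_add p₅ p₆))))).trans ?_
    -- The budget is `β/4 + β/12` plus four times `β/8`, in total `5β/6`.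
    rw [← ENNReal.ofReal_add (by positivity) (by positivity),
      ← ENNReal.ofReal_add (by positivity) (by positivity),
      ← ENNReal.ofReal_add (by positivity) (by positivity),
      ← ENNReal.ofReal_add (by positivity) (by positivity),
      ← ENNReal.ofReal_add (by positivity) (by positivity)]
    exact ENNReal.ofReal_le_ofReal (by linarith)
  · rintro ⟨x, ω⟩ hp
    by_contra! hgood
    refine hp ?_
    obtain ⟨g₁, g₂, g₃, g₄, g₅, g₆⟩ := hgood
    simp only [Set.mem_ofPred_eq, not_exists, not_lt, not_le] at g₁ g₂ g₃ g₄ g₅ g₆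
    -- Since `‖Σ^{1/2}‖ ≤ σ_max`, the first good event puts every sample inside the clipping ball.
    have hx : ∀ i, ‖x i‖ ≤ R' := by
      intro i
      have h1 : ‖x i‖ ≤ ‖μ‖ + ‖x i - μ‖ := by
        simpa using norm_add_le μ (x i - μ)
      have h2 : s * (2 * √((d : ℝ) + Real.log (4 * n / β))) ≤
          σmax * (2 * √((d : ℝ) + Real.log (4 * n / β))) := by gcongr
      rw [hR'def, clipRadius]
      linarith [g₁ i]
    have hG : ∀ i j, |∑ l, (hadamard (padExp d) j l : ℝ) *
        ((pad (quantize R' b (clip R' (x i))) l : ℝ) - padCenter R' b μ l) *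
          (sign (ω.1 l) : ℝ)| ≤ (s * (2 * √((d : ℝ) + Real.log (4 * n / β))) + √(d : ℝ) * b) *
            √(2 * Real.log (16 * n * D / β)) / b := by
      intro i j
      refine (g₅ i j).trans ?_
      have := sqrt_sum_pad_quantize_sub_le (R' := R') hb (g₁ i)
      rw [clip_eq_self (hx i)]
      exact (mul_le_mul_of_nonneg_right this (Real.sqrt_nonneg _)).trans_eq (by ring)
    have hfin := norm_gaussianMeanEst_sub_le (ω := ω) hd hn hσ hρ hx g₂ hG g₃ (by linarith) g₄
    refine hfin.trans ?_
    rw [← hbdef, hbdef, bucket_eq hd]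
    exact error_bound hd' hn' hD1' hD' hτ0 hρ hβ hβ1 hσ hs ht1 (norm_nonneg _) g₆

end PrivMean

theorem mainTheorem8 :
    ∃ c₀ C : ℝ, 0 < c₀ ∧ 0 < C ∧
      ∀ (d n : ℕ) (R σmin σmax ρ β : ℝ) (μ : EuclideanSpace ℝ (Fin d))
        (S : Matrix (Fin d) (Fin d) ℝ),
        1 ≤ d → 2 ≤ n → 0 < σmin → σmin ≤ σmax → 0 < ρ → 0 < β → β < 1 →
        ‖μ‖ ≤ R →
        (S - σmin ^ 2 • (1 : Matrix (Fin d) (Fin d) ℝ)).PosSemidef →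
        (σmax ^ 2 • (1 : Matrix (Fin d) (Fin d) ℝ) - S).PosSemidef →
        c₀ * (PrivMean.tau d n R σmin σmax ρ β * √(d : ℝ)) ≤ (n : ℝ) →
        ((Measure.pi fun _ : Fin n => multivariateGaussian μ S).prod
            (PrivMean.noiseLaw (2 ^ PrivMean.padExp d) (PrivMean.univMax d n R σmin σmax β)))
          {p | ¬ ‖PrivMean.gaussianMeanEst R σmin σmax ρ β p.1 p.2 - μ‖ ≤
            C * (PrivMean.sqrtNorm S * √((d : ℝ) + Real.log ((n : ℝ) / β)) *
              (1 / √(n : ℝ) +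
                √(d : ℝ) * Real.log ((n : ℝ) * (d : ℝ) / β) / (√ρ * (n : ℝ)) +
                PrivMean.tau d n R σmin σmax ρ β * Real.log ((n : ℝ) * (d : ℝ) / β) / (n : ℝ)))}
          ≤ ENNReal.ofReal β :=
  ⟨24, 2000, by norm_num, by norm_num, fun _ _ _ _ _ _ _ _ _ hd hn hσ hσσ hρ hβ hβ1 hμ hS1 hS2 h =>
    PrivMean.gaussianMeanEst_failure_le hd hn hσ hσσ hρ hβ hβ1 hμ hS1 hS2 h⟩
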